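/- There is an absolute constant $C$, and for every $\alpha\in(0,1)$ there are constants $c>0$ and $d_0$ depending only on $\alpha$, such that the following holds for all integers $K\ge 2$ and $d\ge d_0$ with $K\le d^{\alpha}$ and all $0<\gamma\le K^{-C}$. Let $\mathcal L_{d,K}$ be the class of $K$-class linear classifiers $f(\mathbf x)=\mathrm{argmax}_{i\in[K]}(\mathbf w^{(i)}\cdot\mathbf x+t_i)$ on $\mathbb R^d$, with ties resolved by the smallest index. A partial label distribution for $f\in\mathcal L_{d,K}$ with parameter $\gamma$ is a distribution $D$ of pairs $(\mathbf x,S)\in\mathbb R^d\times 2^{[K]}$ for which there is a row-stochastic matrix $\mathbf H\in\mathbb R^{[K]\times 2^{[K]}}$ with $\Pr[S=T\mid\mathbf x]=\mathbf H_{f(\mathbf x),T}$ for all $\mathbf x$ and $T$, with $\mathbf H_{i,T}=0$ whenever $i\notin T$, and with $\sum_{T\not\ni y}\mathbf H_{f(\mathbf x),T}\ge\gamma$ for all $\mathbf x$ and all $y\ne f(\mathbf x)$. It is a contrastive label distribution if $\mathbf H$ can moreover be chosen with $\mathbf H_{i,T}=0$ whenever $|T|\ne K-1$. A query to $\mathrm{VSTAT}(u)$,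 $u>0$, is a measurable function $q:\mathbb R^d\times 2^{[K]}\to[-1,1]$; a valid oracle for $D$ answers it by a number within $\max\bigl(1/u,\sqrt{\mathrm{Var}_D[q]/u}\bigr)$ of $\mathbb E_D[q]$. An SQ algorithm asks adaptively chosen queries, with parameters $u$ of its choice, and may be randomized. Consider any SQ algorithm that learns $\mathcal L_{d,K}$ from partial labels with parameter $\gamma$ under the standard Gaussian to error $1/(2K)$; that is, for every $f\in\mathcal L_{d,K}$, every partial label distribution $D$ for $f$ with parameter $\gamma$ and $\mathbf x$-marginal $\mathcal N(\mathbf 0,\mathbf I)$, and every valid oracle for $D$ (a fixed function of the query and of $u$), it outputs with probability at least $2/3$ a measurable $h:\mathbb R^d\to[K]$ with $\Pr_{\mathbf x\sim\mathcal N(\mathbf 0,\mathbf I)}[h(\mathbf x)\neq f(\mathbf x)]\le 1/(2K)$. Then the algorithm requires either $2^{d^{c}}$ queries or at least one query to $\mathrm{VSTAT}(u)$ with $u\ge d^{cK}$: for some such $f$ and $D$ and some valid oracle for $D$, with positive probability it makes at least $2^{d^{c}}$ queries or makes a query to $\mathrm{VSTAT}(u)$ with $u\ge d^{cK}$. The same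 holds when partial label distributions are replaced throughout by contrastive label distributions. -/

import Mathlib

open MeasureTheory ProbabilityTheory
open scoped ENNReal

universe u

/-! ### Statistical query algorithms -/

/-- A statistical query on `X`: a (measurable) function `q : X → [-1, 1]`. -/
structure StatQuery (X : Type*) [MeasurableSpace X] where
  toFun : X → ℝ
  measurable_toFun : Measurable toFun
  mem_Icc : ∀ x, toFun x ∈ Set.Icc (-1 : ℝ) 1

/-- An oracle answers a query `q` asked with parameter `u > 0` by a real number. -/
abbrev SQOracle (X : Type*) [MeasurableSpace X] : Type _ :=
  StatQuery X → {u : ℝ // 0 < u} → ℝ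

/-- `O` is a valid `VSTAT` oracle for the distribution `D`: for every `u > 0`, the answer to `q` at
parameter `u` is within `max (1/u, √(Var_D[q] / u))` of `E_D[q]`. -/
def IsVSTAT {X : Type*} [MeasurableSpace X] (D : Measure X) (O : SQOracle X) : Prop :=
  ∀ (q : StatQuery X) (u : {u : ℝ // 0 < u}),
    |O q u - ∫ x, q.toFun x ∂D| ≤ max (1 / (u : ℝ)) (Real.sqrt (variance q.toFun D / (u : ℝ)))

/-- A deterministic SQ algorithm on `X` with outputs in `H`: either it stops and outputs an element
of `H`, or it asks a query `q` to `VSTAT(u)` for some `u > 0` of its choice and continues in a way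
that depends arbitrarily on the answer. -/
inductive SQAlgorithm (X : Type*) [MeasurableSpace X] (H : Type*) where
  | output (h : H) : SQAlgorithm X H
  | query (q : StatQuery X) (u : {u : ℝ // 0 < u}) (next : ℝ → SQAlgorithm X H) : SQAlgorithm X H

namespace SQAlgorithm

variable {X : Type*} [MeasurableSpace X] {H : Type*}

/-- The output of the algorithm when its queries are answered by `O`. -/
def run (O : SQOracle X) : SQAlgorithm X H → H
  | output h => h
  | query q u next => run O (next (O q u))

/-- The list of queries, with their parameters, that the algorithm asks when answered by `O`. -/
def queries (O : SQOracle X) : SQAlgorithm X H → List (StatQuery X × {u : ℝ // 0 < u})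
  | output _ => []
  | query q u next => (q, u) :: queries O (next (O q u))

end SQAlgorithm

/-! ### Multiclass linear classifiers and partial labels -/

/-- `f` is a `K`-class linear classifier on `ℝ^d`: `f x = argmax_i (w⁽ⁱ⁾ · x + t_i)`, where ties are
resolved by selecting the smallest index. -/
def IsLinearClassifier {d K : ℕ} (f : EuclideanSpace ℝ (Fin d) → Fin K) : Prop :=
  ∃ (w : Fin K → EuclideanSpace ℝ (Fin d)) (t : Fin K → ℝ), ∀ x,
    (∀ j, inner ℝ (w j) x + t j ≤ inner ℝ (w (f x)) x + t (f x)) ∧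
    (∀ j, j < f x → inner ℝ (w j) x + t j < inner ℝ (w (f x)) x + t (f x))

/-- `H` is a confusion matrix for partial labels of `f` with parameter `γ`: it is row stochastic,
the observed set always contains the true label, and every wrong label is missing from the observed
set with probability at least `γ`. -/
structure IsConfusionMatrix {d K : ℕ} (f : EuclideanSpace ℝ (Fin d) → Fin K) (γ : ℝ)
    (H : Matrix (Fin K) (Finset (Fin K)) ℝ) : Prop where
  nonneg : ∀ i S, 0 ≤ H i S
  row_sum : ∀ i, ∑ S, H i S = 1
  eq_zero : ∀ i S, i ∉ S → H i S = 0
  le_missing : ∀ x y, y ≠ f x → γ ≤ ∑ S with y ∉ S, H (f x) S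

/-- Under `D`, the conditional law of the label set is `Pr[S = T | x] = H (f x) T`. -/
def HasConfusionMatrix {d K : ℕ} (D : Measure (EuclideanSpace ℝ (Fin d) × Finset (Fin K)))
    (f : EuclideanSpace ℝ (Fin d) → Fin K) (H : Matrix (Fin K) (Finset (Fin K)) ℝ) : Prop :=
  ∀ (A : Set (EuclideanSpace ℝ (Fin d))) (T : Finset (Fin K)), MeasurableSet A →
    D (A ×ˢ {T}) = ∫⁻ x in A, ENNReal.ofReal (H (f x) T) ∂(D.map Prod.fst)

/-- The pairs `(D, f)` where `f` is a `K`-class linear classifier and `D` is a partial label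
distribution for `f` with parameter `γ` whose `x`-marginal is the standard Gaussian. -/
def partialLabelInstances (d K : ℕ) (γ : ℝ) :
    Set (Measure (EuclideanSpace ℝ (Fin d) × Finset (Fin K)) ×
      (EuclideanSpace ℝ (Fin d) → Fin K)) :=
  {p | IsLinearClassifier p.2 ∧
    p.1.map Prod.fst = stdGaussian (EuclideanSpace ℝ (Fin d)) ∧
    ∃ H, IsConfusionMatrix p.2 γ H ∧ HasConfusionMatrix p.1 p.2 H}

/-- The contrastive special case: the observed set is always the complement of a single (wrong)
label, so observing it is the same as observing that label. -/
def contrastiveLabelInstances (d K : ℕ) (γ : ℝ) :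
    Set (Measure (EuclideanSpace ℝ (Fin d) × Finset (Fin K)) ×
      (EuclideanSpace ℝ (Fin d) → Fin K)) :=
  {p | IsLinearClassifier p.2 ∧
    p.1.map Prod.fst = stdGaussian (EuclideanSpace ℝ (Fin d)) ∧
    ∃ H, IsConfusionMatrix p.2 γ H ∧ (∀ i S, S.card + 1 ≠ K → H i S = 0) ∧
      HasConfusionMatrix p.1 p.2 H}

/-- A hypothesis: a measurable function `ℝ^d → [K]`. -/
abbrev Hypothesis (d K : ℕ) : Type :=
  {h : EuclideanSpace ℝ (Fin d) → Fin K // Measurable h}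

/-- The randomized SQ algorithm `A` (with random seed `ω ∼ μ`) learns the instances `I` to error
`ε`: for every `(D, f) ∈ I` and every valid oracle for `D`, with probability at least `2/3` it
outputs a hypothesis `h` with `Pr_{x ∼ N(0, I)}[h x ≠ f x] ≤ ε`. -/
def LearnsToError {d K : ℕ} {Ω : Type*} [MeasurableSpace Ω] (μ : Measure Ω)
    (A : Ω → SQAlgorithm (EuclideanSpace ℝ (Fin d) × Finset (Fin K)) (Hypothesis d K))
    (I : Set (Measure (EuclideanSpace ℝ (Fin d) × Finset (Fin K)) ×
      (EuclideanSpace ℝ (Fin d) → Fin K))) (ε : ℝ) : Prop :=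
  ∀ D f, (D, f) ∈ I → ∀ O, IsVSTAT D O →
    ∃ G : Set Ω, MeasurableSet G ∧ (2 / 3 : ℝ≥0∞) ≤ μ G ∧ ∀ ω ∈ G,
      stdGaussian (EuclideanSpace ℝ (Fin d)) {x | ((A ω).run O).1 x ≠ f x} ≤ ENNReal.ofReal ε

/-- Any randomized SQ algorithm that learns the instances `I` to error `ε` requires either at least
`N` queries or at least one query to `VSTAT(u)` with `u ≥ U`: on some instance in `I` and some valid
oracle for it, with positive probability, it makes at least `N` queries or such a query. -/
def LearningRequires {d K : ℕ}
    (I : Set (Measure (EuclideanSpace ℝ (Fin d) × Finset (Fin K)) ×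
      (EuclideanSpace ℝ (Fin d) → Fin K))) (ε N U : ℝ) : Prop :=
  ∀ (Ω : Type u) [MeasurableSpace Ω] (μ : Measure Ω) [IsProbabilityMeasure μ]
    (A : Ω → SQAlgorithm (EuclideanSpace ℝ (Fin d) × Finset (Fin K)) (Hypothesis d K)),
    LearnsToError μ A I ε →
      ∃ D f, (D, f) ∈ I ∧ ∃ O, IsVSTAT D O ∧
        0 < μ {ω | N ≤ (((A ω).queries O).length : ℝ) ∨
          ∃ p ∈ (A ω).queries O, U ≤ (p.2 : ℝ)}

/-!
Hide a random plane in `ℝ^d` and let the label of `x` be the sector, among `K` equal ones, that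
contains the projection of `x` to the plane. When the label is `i`, exclude the label `j` with
probability `(1 - cos (2πk(i - j)/K)) / K`, where `k` is coprime to `K` and lies between `K/6` and
`K/2`. All polynomials of degree less than `k` on the plane are orthogonal to the `k`-th angular
frequency. Hence, for two planes with isometric frames `U`, `V` such that `⟪U p, V q⟫ = r⟪p, q⟫`,
the label laws have correlation at most `M (C |r|) ^ k` relative to the law where the excluded label
is uniform and independent of `x`.

Frames of this kind are indexed by sign vectors in dimension `n = d/2`, with `r` the normalised
inner product of the sign vectors. By Hoeffding's inequality `r` is small for all but an
exponentially small fraction of the pairs, so no query distinguishes more than a tiny fraction of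
the laws from the uniform one. Answered by the uniform law, the algorithm outputs one hypothesis for
most planes, but an accurate hypothesis for a plane is a function of `(x, S)` that correlates with
the law of that plane, and a bounded function correlates with few of them.
-/

section Gaussian

variable {E : Type*} [NormedAddCommGroup E] [InnerProductSpace ℝ E] [FiniteDimensional ℝ E]
  [MeasurableSpace E] [BorelSpace E]

lemma integral_cexp_inner_add_inner_mul_I_stdGaussian (s t : E) :
    ∫ x, Complex.exp (inner ℝ s x + inner ℝ t x * Complex.I) ∂stdGaussian E =
      Complex.exp ((‖s‖ ^ 2 - ‖t‖ ^ 2) / 2 + inner ℝ s t * Complex.I) := by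
  set b := stdOrthonormalBasis ℝ E
  set z : Fin (Module.finrank ℝ E) → ℂ :=
    fun i => (inner ℝ s (b i) : ℂ) + inner ℝ t (b i) * Complex.I
  have hcoord (x : Fin (Module.finrank ℝ E) → ℝ) :
      Complex.exp (inner ℝ s (∑ i, x i • b i) + inner ℝ t (∑ i, x i • b i) * Complex.I) =
        ∏ i, Complex.exp (z i * x i) := by
    rw [← Complex.exp_sum, inner_sum, inner_sum]
    simp only [real_inner_smul_right, Complex.ofReal_sum, Complex.ofReal_mul, Finset.sum_mul,
      ← Finset.sum_add_distrib, z]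
    congr! 2
    ring
  have hgauss (w : ℂ) :
      ∫ x : ℝ, Complex.exp (w * x) ∂gaussianReal 0 1 = Complex.exp (w ^ 2 / 2) := by
    simpa [complexMGF] using complexMGF_id_gaussianReal (μ := 0) (v := 1) w
  have hsq : ∑ i, z i ^ 2 / 2 = (‖s‖ ^ 2 - ‖t‖ ^ 2) / 2 + inner ℝ s t * Complex.I := by
    rw [← Complex.ofReal_pow, ← Complex.ofReal_pow, ← b.sum_sq_inner_left s,
      ← b.sum_sq_inner_left t, ← b.sum_inner_mul_inner s t]
    simp only [z, real_inner_comm t]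
    push_cast
    rw [← Finset.sum_sub_distrib, Finset.sum_div, Finset.sum_mul, ← Finset.sum_add_distrib]
    refine Finset.sum_congr rfl fun i _ => ?_
    linear_combination (inner ℝ t (b i) : ℂ) ^ 2 / 2 * Complex.I_sq
  rw [stdGaussian, integral_map (Measurable.aemeasurable (by fun_prop)) (by fun_prop)]
  simp only [hcoord, b]
  rw [integral_fintype_prod_eq_prod (f := fun i (x : ℝ) => Complex.exp (z i * x))]
  simp_rw [hgauss]
  rw [← Complex.exp_sum, hsq]

lemma integrable_exp_inner_stdGaussian (s : E) :
    Integrable (fun x => Real.exp (inner ℝ s x)) (stdGaussian E) := by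
  have hcexp : Integrable (fun x => Complex.exp (inner ℝ s x + inner ℝ 0 x * Complex.I))
      (stdGaussian E) := .of_integral_ne_zero <| by
    rw [integral_cexp_inner_add_inner_mul_I_stdGaussian]
    exact Complex.exp_ne_zero _
  simpa [Complex.norm_exp] using hcexp.norm

/-- The Cameron–Martin formula. -/
theorem stdGaussian_map_add_right (s : E) :
    (stdGaussian E).map (· + s) = (stdGaussian E).withDensity
      fun x => ENNReal.ofReal (Real.exp (inner ℝ s x - ‖s‖ ^ 2 / 2)) := by
  have : IsProbabilityMeasure ((stdGaussian E).map (· + s)) :=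
    Measure.isProbabilityMeasure_map (by fun_prop)
  have hint : Integrable (fun x => Real.exp (inner ℝ s x - ‖s‖ ^ 2 / 2)) (stdGaussian E) := by
    simpa only [Real.exp_sub] using (integrable_exp_inner_stdGaussian s).div_const _
  have := isFiniteMeasure_withDensity_ofReal hint.2
  refine Measure.ext_of_charFun (funext fun t => ?_)
  have hexp (x : E) : (ENNReal.ofReal (Real.exp (inner ℝ s x - ‖s‖ ^ 2 / 2))).toReal •
      Complex.exp (inner ℝ x t * Complex.I) =
        Complex.exp (-‖s‖ ^ 2 / 2) * Complex.exp (inner ℝ s x + inner ℝ t x * Complex.I) := by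
    rw [ENNReal.toReal_ofReal (Real.exp_nonneg _), Complex.real_smul, Complex.ofReal_exp,
      ← Complex.exp_add, ← Complex.exp_add, real_inner_comm x t]
    push_cast
    ring_nf
  rw [charFun_map_add_const, charFun_stdGaussian, charFun_apply,
    integral_withDensity_eq_integral_toReal_smul (by fun_prop) (by simp)]
  simp_rw [hexp]
  rw [integral_const_mul, integral_cexp_inner_add_inner_mul_I_stdGaussian, ← Complex.exp_add,
    ← Complex.exp_add]
  ring_nf

lemma integral_add_right_stdGaussian (s : E) (f : E → ℝ) :
    ∫ x, f (x + s) ∂stdGaussian E =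
      Real.exp (-(‖s‖ ^ 2 / 2)) * ∫ x, Real.exp (inner ℝ s x) * f x ∂stdGaussian E := by
  rw [← (measurableEmbedding_addRight s).integral_map f, stdGaussian_map_add_right,
    integral_withDensity_eq_integral_toReal_smul (by fun_prop) (by simp), ← integral_const_mul]
  simp_rw [ENNReal.toReal_ofReal (Real.exp_nonneg _), smul_eq_mul, sub_eq_add_neg, Real.exp_add]
  congr! 2
  ring

end Gaussian

lemma abs_exp_sub_sum_le {x q X : ℝ} (hq : 0 ≤ q) (hq1 : q ≤ 1) (hX : 0 ≤ X) (hx : |x| ≤ q * X)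
    (n : ℕ) :
    |Real.exp x - ∑ m ∈ Finset.range n, x ^ m / (m.factorial : ℝ)| ≤ q ^ n * Real.exp X := by
  have htail (y : ℝ) : HasSum (fun m : ℕ => y ^ (m + n) / ((m + n).factorial : ℝ))
      (Real.exp y - ∑ m ∈ Finset.range n, y ^ m / (m.factorial : ℝ)) := by
    rw [Real.exp_eq_exp_ℝ]
    exact (hasSum_nat_add_iff' n).mpr (NormedSpace.expSeries_div_hasSum_exp y)
  have hterm (m : ℕ) : ‖x ^ (m + n) / ((m + n).factorial : ℝ)‖ ≤
      q ^ n * (X ^ (m + n) / ((m + n).factorial : ℝ)) := by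
    rw [norm_div, norm_pow, Real.norm_eq_abs, Real.norm_natCast, ← mul_div_assoc]
    gcongr
    calc |x| ^ (m + n) ≤ (q * X) ^ (m + n) := by gcongr
      _ = q ^ (m + n) * X ^ (m + n) := mul_pow ..
      _ ≤ q ^ n * X ^ (m + n) := by
        gcongr ?_ * _
        exact pow_le_pow_of_le_one hq hq1 (Nat.le_add_left n m)
  rw [← (htail x).tsum_eq, ← Real.norm_eq_abs]
  refine (tsum_of_norm_bounded ((htail X).mul_left (q ^ n)) hterm).trans ?_
  gcongr
  exact sub_le_self _ (Finset.sum_nonneg fun m _ => by positivity)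

lemma abs_integral_exp_mul_le {Ω : Type*} [MeasurableSpace Ω] {μ : Measure Ω} {L X g : Ω → ℝ}
    {q : ℝ} {k : ℕ} (hL : Measurable L) (hg : Measurable g) (hq : 0 ≤ q) (hq1 : q ≤ 1)
    (hX : ∀ ω, 0 ≤ X ω) (hLX : ∀ ω, |L ω| ≤ q * X ω)
    (hint : Integrable (fun ω => Real.exp (X ω)) μ) (hg1 : ∀ ω, |g ω| ≤ 1)
    (hmom : ∀ m < k, ∫ ω, L ω ^ m * g ω ∂μ = 0) :
    |∫ ω, Real.exp (L ω) * g ω ∂μ| ≤ q ^ k * ∫ ω, Real.exp (X ω) ∂μ := by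
  have hLX' (ω : Ω) : |L ω| ≤ X ω := (hLX ω).trans (mul_le_of_le_one_left (hX ω) hq1)
  have hpow (m : ℕ) : Integrable (fun ω => L ω ^ m * g ω) μ := by
    refine (hint.const_mul (m.factorial : ℝ)).mono' (by fun_prop) (.of_forall fun ω => ?_)
    have hfact := Real.pow_div_factorial_le_exp _ (hX ω) m
    rw [div_le_iff₀' (by positivity)] at hfact
    rw [norm_mul, norm_pow, Real.norm_eq_abs, Real.norm_eq_abs]
    exact (mul_le_of_le_one_right (by positivity) (hg1 ω)).trans
      ((pow_le_pow_left₀ (abs_nonneg _) (hLX' ω) m).trans hfact)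
  have hexp : Integrable (fun ω => Real.exp (L ω) * g ω) μ := by
    refine hint.mono' (by fun_prop) (.of_forall fun ω => ?_)
    rw [norm_mul, Real.norm_eq_abs, Real.norm_eq_abs, Real.abs_exp]
    exact (mul_le_of_le_one_right (Real.exp_nonneg _) (hg1 ω)).trans
      (Real.exp_le_exp.mpr ((le_abs_self _).trans (hLX' ω)))
  have hterm (m : ℕ) (ω : Ω) : L ω ^ m / (m.factorial : ℝ) * g ω =
      (m.factorial : ℝ)⁻¹ * (L ω ^ m * g ω) := by ring
  have hremainder : ∫ ω, Real.exp (L ω) * g ω ∂μ =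
      ∫ ω, (Real.exp (L ω) - ∑ m ∈ Finset.range k, L ω ^ m / (m.factorial : ℝ)) * g ω ∂μ := by
    simp_rw [sub_mul, Finset.sum_mul, hterm]
    rw [integral_sub hexp (integrable_finsetSum _ fun m _ => (hpow m).const_mul _),
      integral_finsetSum _ fun m _ => (hpow m).const_mul _, Finset.sum_eq_zero, sub_zero]
    intro m hm
    rw [integral_const_mul, hmom m (Finset.mem_range.mp hm), mul_zero]
  rw [hremainder, ← integral_const_mul, ← Real.norm_eq_abs]
  refine norm_integral_le_of_norm_le (hint.const_mul _) (.of_forall fun ω => ?_)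
  rw [norm_mul]
  exact (mul_le_of_le_one_right (norm_nonneg _) (hg1 ω)).trans
    (abs_exp_sub_sum_le hq hq1 (hX ω) (hLX ω) k)

section Gaussian

variable {E : Type*} [NormedAddCommGroup E] [InnerProductSpace ℝ E] [FiniteDimensional ℝ E]
  [MeasurableSpace E] [BorelSpace E]

lemma abs_integral_smul_add_smul_le {C₀ r σ : ℝ} {g : E → ℝ} {k : ℕ}
    (hint : Integrable (fun w : E => Real.exp (C₀ * ‖w‖ ^ 2)) (stdGaussian E)) (hg : Measurable g)
    (hg1 : ∀ z, |g z| ≤ 1) (hscale : ∀ (a : ℝ) (z : E), 0 < a → g (a • z) = g z)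
    (hmom : ∀ s : E, ∀ m < k, ∫ w, inner ℝ s w ^ m * g w ∂stdGaussian E = 0)
    (hC₀ : 0 < C₀) (hσ : 0 < σ) (hr : |r| / (σ * C₀) ≤ 1) (z : E) :
    |∫ w, g (r • z + σ • w) ∂stdGaussian E| ≤
      (|r| / (σ * C₀)) ^ k *
        (Real.exp (C₀ * ‖z‖ ^ 2) * ∫ w, Real.exp (C₀ * ‖w‖ ^ 2) ∂stdGaussian E) := by
  set s : E := (r / σ) • z with hs
  have hshift (w : E) : g (r • z + σ • w) = g (w + s) := by
    rw [← hscale σ (w + s) hσ, hs, smul_add, smul_smul, mul_div_cancel₀ _ hσ.ne', add_comm]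
  have hnorm : ‖s‖ = |r| / (σ * C₀) * C₀ * ‖z‖ := by
    rw [hs, norm_smul, norm_div, Real.norm_eq_abs, Real.norm_eq_abs, abs_of_pos hσ]
    field_simp
  have hinner (w : E) : |inner ℝ s w| ≤ |r| / (σ * C₀) * (C₀ * ‖z‖ ^ 2 + C₀ * ‖w‖ ^ 2) :=
    calc |inner ℝ s w| ≤ ‖s‖ * ‖w‖ := abs_real_inner_le_norm s w
      _ = |r| / (σ * C₀) * (C₀ * (‖z‖ * ‖w‖)) := by rw [hnorm]; ring
      _ ≤ |r| / (σ * C₀) * (C₀ * (‖z‖ ^ 2 + ‖w‖ ^ 2)) := by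
        gcongr
        nlinarith [sq_nonneg (‖z‖ - ‖w‖), sq_nonneg ‖z‖, sq_nonneg ‖w‖]
      _ = _ := by ring
  have hlaplace := abs_integral_exp_mul_le (by fun_prop) hg (by positivity) hr
    (fun w => by positivity) hinner (by simpa only [Real.exp_add] using hint.const_mul _) hg1
    (hmom s)
  simp_rw [Real.exp_add, integral_const_mul] at hlaplace
  simp_rw [hshift]
  rw [integral_add_right_stdGaussian, abs_mul, Real.abs_exp]
  exact (mul_le_of_le_one_left (abs_nonneg _)
    (Real.exp_le_one_iff.mpr (by simp only [neg_nonpos]; positivity))).trans hlaplace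

lemma abs_integral_prod_mul_le {C₀ r σ : ℝ} {g g' : E → ℝ} {k : ℕ}
    (hint : Integrable (fun w : E => Real.exp (C₀ * ‖w‖ ^ 2)) (stdGaussian E))
    (hg : Measurable g) (hg' : Measurable g') (hg1 : ∀ z, |g z| ≤ 1) (hg1' : ∀ z, |g' z| ≤ 1)
    (hscale : ∀ (a : ℝ) (z : E), 0 < a → g' (a • z) = g' z)
    (hmom : ∀ s : E, ∀ m < k, ∫ w, inner ℝ s w ^ m * g' w ∂stdGaussian E = 0)
    (hC₀ : 0 < C₀) (hσ : 0 < σ) (hr : |r| / (σ * C₀) ≤ 1) :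
    |∫ p : E × E, g p.1 * g' (r • p.1 + σ • p.2) ∂(stdGaussian E).prod (stdGaussian E)| ≤
      (|r| / (σ * C₀)) ^ k * (∫ w, Real.exp (C₀ * ‖w‖ ^ 2) ∂stdGaussian E) ^ 2 := by
  have hprod : Integrable (fun p : E × E => g p.1 * g' (r • p.1 + σ • p.2))
      ((stdGaussian E).prod (stdGaussian E)) :=
    .of_bound (by fun_prop) 1 (.of_forall fun p => by
      rw [norm_mul]
      exact mul_le_one₀ (hg1 _) (abs_nonneg _) (hg1' _))
  rw [integral_prod _ hprod, sq, ← integral_mul_const, ← integral_const_mul, ← Real.norm_eq_abs]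
  refine norm_integral_le_of_norm_le ((hint.mul_const _).const_mul _) (.of_forall fun z => ?_)
  simp only [integral_const_mul, norm_mul]
  exact (mul_le_of_le_one_left (norm_nonneg _) (hg1 z)).trans
    (abs_integral_smul_add_smul_le hint hg' hg1' hscale hmom hC₀ hσ hr z)

lemma exists_abs_integral_prod_mul_le (E : Type*) [NormedAddCommGroup E] [InnerProductSpace ℝ E]
    [FiniteDimensional ℝ E] [MeasurableSpace E] [BorelSpace E] :
    ∃ M C : ℝ, 1 ≤ M ∧ 1 ≤ C ∧ ∀ (k : ℕ) (g g' : E → ℝ), Measurable g → Measurable g' →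
      (∀ z, |g z| ≤ 1) → (∀ z, |g' z| ≤ 1) → (∀ (a : ℝ) (z : E), 0 < a → g' (a • z) = g' z) →
      (∀ s : E, ∀ m < k, ∫ w, inner ℝ s w ^ m * g' w ∂stdGaussian E = 0) →
      ∀ r σ : ℝ, 0 < σ → r ^ 2 + σ ^ 2 = 1 →
        |∫ p : E × E, g p.1 * g' (r • p.1 + σ • p.2) ∂(stdGaussian E).prod (stdGaussian E)| ≤
          M * (C * |r|) ^ k := by
  obtain ⟨C₀, hC₀, hint⟩ := IsGaussian.exists_integrable_exp_sq (stdGaussian E)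
  set I := ∫ w, Real.exp (C₀ * ‖w‖ ^ 2) ∂stdGaussian E
  have hC : 0 < 2 / C₀ := by positivity
  refine ⟨1 + I ^ 2, 2 + 2 / C₀, le_add_of_nonneg_right (sq_nonneg I), by linarith, ?_⟩
  intro k g g' hg hg' hg1 hg1' hscale hmom r σ hσ hrσ
  by_cases hlarge : 1 ≤ (2 + 2 / C₀) * |r|
  · have htrivial : |∫ p : E × E, g p.1 * g' (r • p.1 + σ • p.2)
        ∂(stdGaussian E).prod (stdGaussian E)| ≤ 1 := by
      simpa using norm_integral_le_of_norm_le_const (μ := (stdGaussian E).prod (stdGaussian E))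
        (C := 1) (.of_forall fun p : E × E => (norm_mul (g p.1) _).trans_le
          (mul_le_one₀ (hg1 _) (abs_nonneg _) (hg1' (r • p.1 + σ • p.2))))
    exact htrivial.trans (one_le_mul_of_one_le_of_one_le (le_add_of_nonneg_right (sq_nonneg I))
      (one_le_pow₀ hlarge))
  · rw [not_le, add_mul] at hlarge
    have hr := abs_nonneg r
    have hσ2 : 1 / 2 ≤ σ := by nlinarith [sq_abs r, mul_nonneg hC.le hr]
    have hratio : |r| / (σ * C₀) ≤ 2 / C₀ * |r| := by
      rw [div_le_iff₀ (by positivity)]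
      field_simp
      nlinarith
    calc _ ≤ (|r| / (σ * C₀)) ^ k * I ^ 2 :=
          abs_integral_prod_mul_le hint hg hg' hg1 hg1' hscale hmom hC₀ hσ (by linarith)
      _ ≤ ((2 + 2 / C₀) * |r|) ^ k * (1 + I ^ 2) := by
        gcongr
        · linarith
        · linarith
      _ = _ := mul_comm _ _

lemma map_adjoint_prod_adjoint_stdGaussian {F : Type*} [NormedAddCommGroup F]
    [InnerProductSpace ℝ F] [FiniteDimensional ℝ F] [MeasurableSpace F] [BorelSpace F]
    (U V : F →ₗᵢ[ℝ] E) {r σ : ℝ} (hUV : ∀ p q, inner ℝ (U p) (V q) = r * inner ℝ p q)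
    (hrσ : r ^ 2 + σ ^ 2 = 1) :
    (stdGaussian E).map (fun x => (U.toContinuousLinearMap.adjoint x,
      V.toContinuousLinearMap.adjoint x)) =
      ((stdGaussian F).prod (stdGaussian F)).map
        (fun p : F × F => (p.1, r • p.1 + σ • p.2)) := by
  set T : E →L[ℝ] F × F :=
    U.toContinuousLinearMap.adjoint.prod V.toContinuousLinearMap.adjoint
  set S : F × F →L[ℝ] F × F := (ContinuousLinearMap.fst ℝ F F).prod
    (r • ContinuousLinearMap.fst ℝ F F + σ • ContinuousLinearMap.snd ℝ F F)
  change (stdGaussian E).map T = ((stdGaussian F).prod (stdGaussian F)).map S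
  have := Measure.isProbabilityMeasure_map (μ := stdGaussian E) (f := T) (by fun_prop)
  have := Measure.isProbabilityMeasure_map (μ := (stdGaussian F).prod (stdGaussian F)) (f := S)
    (by fun_prop)
  refine Measure.ext_of_charFunDual (funext fun L => ?_)
  set p : F := (InnerProductSpace.toDual ℝ F).symm (L ∘SL ContinuousLinearMap.inl ℝ F F) with hp
  set q : F := (InnerProductSpace.toDual ℝ F).symm (L ∘SL ContinuousLinearMap.inr ℝ F F) with hq
  have hL (z w : F) : L (z, w) = inner ℝ p z + inner ℝ q w := by
    simp [hp, hq, ← map_add]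
  have hT : L ∘SL T = innerSL ℝ (U p + V q) := by
    ext x
    simp [T, hL, ContinuousLinearMap.adjoint_inner_right]
  have hfst : L ∘SL S ∘SL ContinuousLinearMap.inl ℝ F F = innerSL ℝ (p + r • q) := by
    ext z
    simp [S, hL, real_inner_smul_right]
  have hsnd : L ∘SL S ∘SL ContinuousLinearMap.inr ℝ F F = innerSL ℝ (σ • q) := by
    ext z
    simp [S, hL, real_inner_smul_right]
  have hnorm : ‖U p + V q‖ ^ 2 = ‖p + r • q‖ ^ 2 + ‖σ • q‖ ^ 2 := by
    rw [norm_add_sq_real, norm_add_sq_real, hUV, U.norm_map, V.norm_map, norm_smul, norm_smul,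
      real_inner_smul_right, mul_pow, mul_pow, Real.norm_eq_abs, Real.norm_eq_abs, sq_abs, sq_abs]
    linear_combination (-‖q‖ ^ 2) * hrσ
  rw [charFunDual_map, charFunDual_map, charFunDual_prod, ContinuousLinearMap.comp_assoc,
    ContinuousLinearMap.comp_assoc, hT, hfst, hsnd]
  simp only [charFunDual_stdGaussian, innerSL_apply_norm, ← Complex.ofReal_pow, hnorm,
    ← Complex.exp_add]
  push_cast
  ring_nf

end Gaussian

section LeastArgmax

variable {ι α : Type*} [LinearOrder ι] [LinearOrder α]

/-- `i` is the smallest index at which `s` attains its maximum. -/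
def IsLeastArgmax (s : ι → α) (i : ι) : Prop :=
  (∀ j, s j ≤ s i) ∧ ∀ j, j < i → s j < s i

lemma IsLeastArgmax.eq {s : ι → α} {i i' : ι} (h : IsLeastArgmax s i) (h' : IsLeastArgmax s i') :
    i = i' :=
  le_antisymm (le_of_not_gt fun hlt => (h.2 _ hlt).not_ge (h'.1 _))
    (le_of_not_gt fun hlt => (h'.2 _ hlt).not_ge (h.1 _))

lemma isLeastArgmax_of_forall_ne_lt {s : ι → α} {i : ι} (h : ∀ j, j ≠ i → s j < s i) :
    IsLeastArgmax s i :=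
  ⟨fun j => (eq_or_ne j i).elim (fun hj => hj ▸ le_rfl) fun hj => (h j hj).le,
    fun j hj => h j hj.ne⟩

variable [Finite ι] [Nonempty ι]

lemma exists_isLeastArgmax (s : ι → α) : ∃ i, IsLeastArgmax s i := by
  obtain ⟨i, hi, hmin⟩ := WellFounded.has_min (wellFounded_lt (α := ι)) {i | ∀ j, s j ≤ s i}
    (Finite.exists_max s)
  exact ⟨i, hi, fun j hj => lt_of_not_ge fun h => hmin j (fun l => (hi l).trans h) hj⟩

/-- The argmax of `s`, with ties resolved by the smallest index. -/
noncomputable def leastArgmax (s : ι → α) : ι := (exists_isLeastArgmax s).choose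

lemma isLeastArgmax_leastArgmax (s : ι → α) : IsLeastArgmax s (leastArgmax s) :=
  (exists_isLeastArgmax s).choose_spec

lemma leastArgmax_eq_iff {s : ι → α} {i : ι} : leastArgmax s = i ↔ IsLeastArgmax s i :=
  ⟨fun h => h ▸ isLeastArgmax_leastArgmax s, (isLeastArgmax_leastArgmax s).eq⟩

lemma measurable_leastArgmax [MeasurableSpace ι] :
    Measurable (leastArgmax : (ι → ℝ) → ι) := by
  have := Finite.to_countable (α := ι)
  refine measurable_to_countable' fun i => ?_
  have hfiber : (leastArgmax : (ι → ℝ) → ι) ⁻¹' {i} =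
      (⋂ j, {s | s j ≤ s i}) ∩ ⋂ j, ⋂ _ : j < i, {s | s j < s i} := by
    ext s
    simp [leastArgmax_eq_iff, IsLeastArgmax]
  rw [hfiber]
  exact (MeasurableSet.iInter fun j => measurableSet_le (by fun_prop) (by fun_prop)).inter
    (MeasurableSet.iInter fun j => MeasurableSet.iInter fun _ =>
      measurableSet_lt (by fun_prop) (by fun_prop))

end LeastArgmax

section Polygon

variable {K : ℕ} [NeZero K]

/-- The vertices of the regular `K`-gon inscribed in the unit circle, which are the weight vectors
of the sector classifier in the plane. -/
noncomputable def polygonVertex (i : Fin K) : ℂ :=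
  Complex.exp (2 * Real.pi * Complex.I / K) ^ (i : ℕ)

lemma polygonVertex_zero : polygonVertex (0 : Fin K) = 1 := by
  simp [polygonVertex]

lemma polygonVertex_add (i j : Fin K) :
    polygonVertex (i + j) = polygonVertex i * polygonVertex j := by
  rw [polygonVertex, polygonVertex, polygonVertex, ← pow_add, Fin.val_add]
  exact (pow_eq_pow_mod _ (Complex.isPrimitiveRoot_exp K (NeZero.ne K)).pow_eq_one).symm

lemma polygonVertex_pow_card (i : Fin K) : polygonVertex i ^ K = 1 := by
  rw [polygonVertex, pow_right_comm,
    (Complex.isPrimitiveRoot_exp K (NeZero.ne K)).pow_eq_one, one_pow]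

lemma norm_polygonVertex (i : Fin K) : ‖polygonVertex i‖ = 1 :=
  Complex.norm_eq_one_of_pow_eq_one (polygonVertex_pow_card i) (NeZero.ne K)

lemma polygonVertex_ne_zero (i : Fin K) : polygonVertex i ≠ 0 :=
  norm_ne_zero_iff.mp (by simp [norm_polygonVertex])

lemma polygonVertex_one :
    polygonVertex (1 : Fin K) = Complex.exp (2 * Real.pi * Complex.I / K) := by
  conv_rhs => rw [← pow_one (Complex.exp _),
    pow_eq_pow_mod 1 (Complex.isPrimitiveRoot_exp K (NeZero.ne K)).pow_eq_one]
  rw [polygonVertex, Fin.val_one']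

lemma polygonVertex_one_pow (i : Fin K) :
    polygonVertex (1 : Fin K) ^ (i : ℕ) = polygonVertex i := by
  rw [polygonVertex_one, polygonVertex]

lemma isPrimitiveRoot_polygonVertex_one : IsPrimitiveRoot (polygonVertex (1 : Fin K)) K :=
  polygonVertex_one (K := K) ▸ Complex.isPrimitiveRoot_exp K (NeZero.ne K)

lemma polygonVertex_pow_eq_one_iff {k : ℕ} (hk : k.Coprime K) {i : Fin K} :
    polygonVertex i ^ k = 1 ↔ i = 0 := by
  rw [polygonVertex, ← pow_mul,
    (Complex.isPrimitiveRoot_exp K (NeZero.ne K)).pow_eq_one_iff_dvd, hk.symm.dvd_mul_right]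
  exact ⟨fun h => Fin.ext (Nat.eq_zero_of_dvd_of_lt h i.2), fun h => by simp [h]⟩

lemma polygonVertex_injective : Function.Injective (polygonVertex : Fin K → ℂ) := fun i j h =>
  Fin.ext ((Complex.isPrimitiveRoot_exp K (NeZero.ne K)).pow_inj i.2 j.2 h)

/-- The index of the sector of the plane containing `z`: the label that the `K`-class linear
classifier with weights the vertices of the regular `K`-gon gives to `z`. -/
noncomputable def sectorIndex (K : ℕ) [NeZero K] (z : ℂ) : Fin K :=
  leastArgmax fun i : Fin K => inner ℝ (polygonVertex i) z

lemma measurable_sectorIndex : Measurable (sectorIndex K) :=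
  measurable_leastArgmax.comp (measurable_pi_lambda _ fun _ => by fun_prop)

lemma measurable_polygonVertex_sectorIndex :
    Measurable fun z => polygonVertex (sectorIndex K z) :=
  (measurable_of_countable polygonVertex).comp measurable_sectorIndex

lemma sectorIndex_smul {a : ℝ} (ha : 0 < a) (z : ℂ) :
    sectorIndex K (a • z) = sectorIndex K z := by
  have h : IsLeastArgmax _ (sectorIndex K z) := isLeastArgmax_leastArgmax _
  refine leastArgmax_eq_iff.mpr ?_
  simp only [IsLeastArgmax, real_inner_smul_right]
  exact ⟨fun j => by gcongr; exact h.1 j, fun j hj => by gcongr; exact h.2 j hj⟩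

lemma ae_inner_ne_zero_stdGaussian {E : Type*} [NormedAddCommGroup E] [InnerProductSpace ℝ E]
    [FiniteDimensional ℝ E] [MeasurableSpace E] [BorelSpace E] {p : E} (hp : p ≠ 0) :
    ∀ᵐ x ∂stdGaussian E, inner ℝ p x ≠ 0 := by
  have hlaw := IsGaussian.map_eq_gaussianReal (μ := stdGaussian E) (innerSL ℝ p)
  rw [variance_dual_stdGaussian, innerSL_apply_norm] at hlaw
  have := nullSingletonClass_gaussianReal (μ := ∫ x, innerSL ℝ p x ∂stdGaussian E)
    (v := (‖p‖ ^ 2).toNNReal) (by simpa using hp)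
  rw [← hlaw] at this
  exact (ae_map_iff (by fun_prop) (measurableSet_singleton (0 : ℝ)).compl).mp
    (Measure.ae_ne ((stdGaussian E).map (innerSL ℝ p)) 0)

lemma integrable_norm_pow_stdGaussian {E : Type*} [NormedAddCommGroup E] [InnerProductSpace ℝ E]
    [FiniteDimensional ℝ E] [MeasurableSpace E] [BorelSpace E] (m : ℕ) :
    Integrable (fun x => ‖x‖ ^ m) (stdGaussian E) := by
  simpa using (IsGaussian.memLp_id (stdGaussian E) (m : ℝ≥0∞) (by simp)).integrable_norm_pow'

lemma inner_polygonVertex_one_mul (j : Fin K) (z : ℂ) :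
    inner ℝ (polygonVertex j) (polygonVertex (1 : Fin K) * z) =
      inner ℝ (polygonVertex (j - 1)) z := by
  have h : polygonVertex j = polygonVertex (1 : Fin K) * polygonVertex (j - 1) := by
    rw [← polygonVertex_add, add_sub_cancel]
  have hunit : polygonVertex (1 : Fin K) * starRingEnd ℂ (polygonVertex (1 : Fin K)) = 1 := by
    rw [Complex.mul_conj, Complex.normSq_eq_norm_sq, norm_polygonVertex]
    simp
  rw [h, Complex.inner, Complex.inner, map_mul, mul_mul_mul_comm, hunit, one_mul]

lemma ae_sectorIndex_polygonVertex_one_mul :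
    ∀ᵐ z ∂stdGaussian ℂ, sectorIndex K (polygonVertex (1 : Fin K) * z) = sectorIndex K z + 1 := by
  have hinj : ∀ᵐ z ∂stdGaussian ℂ, ∀ i j : Fin K, i ≠ j →
      inner ℝ (polygonVertex i - polygonVertex j) z ≠ 0 := by
    simp_rw [ae_all_iff]
    exact fun i j hij =>
      ae_inner_ne_zero_stdGaussian (sub_ne_zero.mpr (polygonVertex_injective.ne hij))
  filter_upwards [hinj] with z hz
  have hstrict (j : Fin K) (hj : j ≠ sectorIndex K z) :
      inner ℝ (polygonVertex j) z < inner ℝ (polygonVertex (sectorIndex K z)) z := by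
    have hmax : IsLeastArgmax _ (sectorIndex K z) := isLeastArgmax_leastArgmax _
    refine (hmax.1 j).lt_of_ne fun h => hz j _ hj ?_
    rw [inner_sub_left, sub_eq_zero]
    exact h
  refine leastArgmax_eq_iff.mpr (isLeastArgmax_of_forall_ne_lt fun j hj => ?_)
  simp only [inner_polygonVertex_one_mul, add_sub_cancel_right]
  exact hstrict _ fun h => hj (sub_eq_iff_eq_add.mp h)

lemma integral_eq_zero_of_ae_comp_eq_mul {X : Type*} [MeasurableSpace X] {μ : Measure X}
    {T : X → X} (hT : MeasurePreserving T μ μ) (hemb : MeasurableEmbedding T) {f : X → ℂ} {χ : ℂ}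
    (hχ : χ ≠ 1) (hf : ∀ᵐ x ∂μ, f (T x) = χ * f x) : ∫ x, f x ∂μ = 0 := by
  have hinv : ∫ x, f x ∂μ = χ * ∫ x, f x ∂μ := by
    rw [← integral_const_mul, ← integral_congr_ae hf, hT.integral_comp hemb]
  have hmul : (1 - χ) * ∫ x, f x ∂μ = 0 := by rw [sub_mul, ← hinv, one_mul, sub_self]
  exact (mul_eq_zero.mp hmul).resolve_left (sub_ne_zero.mpr hχ.symm)

lemma measurePreserving_polygonVertex_mul (i : Fin K) :
    MeasurePreserving (polygonVertex i * ·) (stdGaussian ℂ) (stdGaussian ℂ) :=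
  ⟨by fun_prop, stdGaussian_map (rotation ⟨polygonVertex i,
    by simp [Submonoid.unitSphere, norm_polygonVertex]⟩)⟩

lemma integral_polygonVertex_sectorIndex_pow_mul_eq_zero {k a b : ℕ} (hk : 2 * k ≤ K)
    (hab : a + b < k) :
    ∫ z, polygonVertex (sectorIndex K z) ^ k * (z ^ a * starRingEnd ℂ z ^ b) ∂stdGaussian ℂ =
      0 := by
  set ω := polygonVertex (1 : Fin K)
  have hconj : starRingEnd ℂ ω = ω⁻¹ := (RCLike.inv_eq_conj (norm_polygonVertex _)).symm
  have hχ : ω ^ (k + a) * ω⁻¹ ^ b ≠ 1 := fun h => by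
    rw [inv_pow, mul_inv_eq_one₀ (pow_ne_zero _ (polygonVertex_ne_zero _))] at h
    have := isPrimitiveRoot_polygonVertex_one.pow_inj (by omega) (by omega) h
    omega
  refine integral_eq_zero_of_ae_comp_eq_mul (measurePreserving_polygonVertex_mul 1)
    (measurableEmbedding_mulLeft₀ (polygonVertex_ne_zero (1 : Fin K))) hχ ?_
  filter_upwards [ae_sectorIndex_polygonVertex_one_mul (K := K)] with z hz
  rw [hz, polygonVertex_add, map_mul, hconj]
  ring

lemma integrable_polygonVertex_sectorIndex_pow_mul (k a b : ℕ) :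
    Integrable (fun z => polygonVertex (sectorIndex K z) ^ k * (z ^ a * starRingEnd ℂ z ^ b))
      (stdGaussian ℂ) := by
  have := measurable_polygonVertex_sectorIndex (K := K)
  refine (integrable_norm_pow_stdGaussian (a + b)).mono'
    (Measurable.aestronglyMeasurable (by fun_prop)) (.of_forall fun z => ?_)
  simp [norm_polygonVertex, pow_add]

lemma integral_inner_pow_mul_polygonVertex_sectorIndex_pow {k m : ℕ} (hk : 2 * k ≤ K)
    (hm : m < k) (s : ℂ) :
    ∫ z, (inner ℝ s z : ℂ) ^ m * polygonVertex (sectorIndex K z) ^ k ∂stdGaussian ℂ = 0 := by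
  have hexpand (z : ℂ) : (inner ℝ s z : ℂ) ^ m * polygonVertex (sectorIndex K z) ^ k =
      ∑ a ∈ Finset.range (m + 1),
        ((starRingEnd ℂ s / 2) ^ a * (s / 2) ^ (m - a) * m.choose a) *
          (polygonVertex (sectorIndex K z) ^ k * (z ^ a * starRingEnd ℂ z ^ (m - a))) := by
    have hinner : (inner ℝ s z : ℂ) =
        starRingEnd ℂ s / 2 * z + s / 2 * starRingEnd ℂ z := by
      rw [Complex.inner]
      apply Complex.ext <;> simp <;> ring
    rw [hinner, add_pow, Finset.sum_mul]
    refine Finset.sum_congr rfl fun a _ => ?_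
    ring
  simp_rw [hexpand]
  rw [integral_finsetSum _ fun a _ =>
    (integrable_polygonVertex_sectorIndex_pow_mul k a (m - a)).const_mul _]
  refine Finset.sum_eq_zero fun a ha => ?_
  have ha' := Finset.mem_range.mp ha
  rw [integral_const_mul, integral_polygonVertex_sectorIndex_pow_mul_eq_zero hk (by omega),
    mul_zero]

end Polygon

section CosKernel

lemma one_div_le_norm_one_sub_of_pow_eq_one {R : Type*} [NormedField R] [NormedAlgebra ℝ R]
    {K : ℕ} [NeZero K] {η : R} (hη : η ^ K = 1) (hne : η ≠ 1) : 1 / (K : ℝ) ≤ ‖1 - η‖ := by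
  have hK : (0 : ℝ) < K := Nat.cast_pos.mpr (NeZero.pos K)
  have hnorm : ‖η‖ = 1 := (pow_eq_one_iff_of_nonneg (norm_nonneg η) (NeZero.ne K)).mp <| by
    rw [← norm_pow, hη, norm_one]
  have hgeom : ∑ m ∈ Finset.range K, η ^ m = 0 := by
    rw [geom_sum_eq hne, hη, sub_self, zero_div]
  have hpow : ∀ m ∈ Finset.range K, ‖1 - η ^ m‖ ≤ K * ‖1 - η‖ := fun m hm => by
    rw [← mul_neg_geom_sum, norm_mul, mul_comm]
    gcongr
    calc ‖∑ i ∈ Finset.range m, η ^ i‖ ≤ ∑ i ∈ Finset.range m, ‖η ^ i‖ := norm_sum_le _ _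
      _ = m := by simp [hnorm]
      _ ≤ K := by exact_mod_cast (Finset.mem_range.mp hm).le
  have hsum : (K : ℝ) ≤ K * (K * ‖1 - η‖) := by
    calc (K : ℝ) = ‖(K : R)‖ := by rw [← map_natCast (algebraMap ℝ R), norm_algebraMap']; simp
      _ = ‖∑ m ∈ Finset.range K, (1 - η ^ m)‖ := by simp [hgeom]
      _ ≤ ∑ m ∈ Finset.range K, ‖1 - η ^ m‖ := norm_sum_le _ _
      _ ≤ K * (K * ‖1 - η‖) := by simpa using Finset.sum_le_card_nsmul _ _ _ hpow
  rw [div_le_iff₀' hK]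
  exact le_of_mul_le_mul_left (by simpa using hsum) hK

variable {K : ℕ} [NeZero K]

/-- The kernel `cos (2πk(i - j) / K)` on pairs of labels, by which the label distributions hidden
in a plane are perturbed. -/
noncomputable def cosKernel (k : ℕ) (i j : Fin K) : ℝ := (polygonVertex (i - j) ^ k).re

lemma abs_cosKernel_le_one (k : ℕ) (i j : Fin K) : |cosKernel k i j| ≤ 1 :=
  (Complex.abs_re_le_norm _).trans_eq (by simp [norm_polygonVertex])

lemma cosKernel_self (k : ℕ) (i : Fin K) : cosKernel k i i = 1 := by
  simp [cosKernel, polygonVertex_zero]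

lemma one_div_le_one_sub_cosKernel {k : ℕ} (hk : k.Coprime K) {i j : Fin K} (hij : i ≠ j) :
    1 / (2 * (K : ℝ) ^ 2) ≤ 1 - cosKernel k i j := by
  set η := polygonVertex (i - j) ^ k
  have hnorm : η.re ^ 2 + η.im ^ 2 = 1 := by
    rw [sq, sq, ← Complex.normSq_apply, Complex.normSq_eq_norm_sq]
    simp [η, norm_polygonVertex]
  have hchord : 1 / (K : ℝ) ≤ ‖1 - η‖ := by
    refine one_div_le_norm_one_sub_of_pow_eq_one ?_
      fun h => hij (sub_eq_zero.mp ((polygonVertex_pow_eq_one_iff hk).mp h))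
    rw [pow_right_comm, polygonVertex_pow_card, one_pow]
  calc 1 / (2 * (K : ℝ) ^ 2) = (1 / K) ^ 2 / 2 := by ring
    _ ≤ ‖1 - η‖ ^ 2 / 2 := by gcongr
    _ = 1 - cosKernel k i j := by
      rw [Complex.sq_norm, Complex.normSq_apply, cosKernel]
      simp only [Complex.sub_re, Complex.sub_im, Complex.one_re, Complex.one_im]
      linear_combination hnorm / 2

lemma sum_polygonVertex_pow {k : ℕ} (hk : polygonVertex (1 : Fin K) ^ k ≠ 1) :
    ∑ i : Fin K, polygonVertex i ^ k = 0 := by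
  have hshift : ∑ i : Fin K, polygonVertex i ^ k =
      polygonVertex (1 : Fin K) ^ k * ∑ i : Fin K, polygonVertex i ^ k := by
    rw [Finset.mul_sum]
    exact (Fintype.sum_equiv (Equiv.addLeft 1) _ _ fun i => by
      simp [polygonVertex_add, mul_pow]).symm
  exact (mul_left_eq_self₀.mp hshift.symm).resolve_left hk

lemma sum_cosKernel {k : ℕ} (hk : k.Coprime K) (hK : 1 < K) (i : Fin K) :
    ∑ j, cosKernel k i j = 0 := by
  have hsum : ∑ j, polygonVertex (i - j) ^ k = ∑ l : Fin K, polygonVertex l ^ k :=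
    (Equiv.subLeft i).sum_comp fun l => polygonVertex l ^ k
  simp_rw [cosKernel]
  rw [← Complex.re_sum, hsum,
    sum_polygonVertex_pow ((isPrimitiveRoot_polygonVertex_one.pow_of_coprime k hk).ne_one hK),
    Complex.zero_re]

lemma le_sum_cosKernel_sq (k : ℕ) (i : Fin K) : (K : ℝ) / 2 ≤ ∑ j, cosKernel k i j ^ 2 := by
  have hsq (l : Fin K) : (polygonVertex l ^ k).re ^ 2 =
      1 / 2 + (polygonVertex l ^ (2 * k)).re / 2 := by
    have hnorm := Complex.normSq_eq_norm_sq (polygonVertex l ^ k)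
    rw [Complex.normSq_apply, norm_pow, norm_polygonVertex, one_pow, one_pow] at hnorm
    rw [mul_comm, pow_mul, sq (polygonVertex l ^ k), Complex.mul_re]
    linear_combination hnorm / 2
  have hnonneg : 0 ≤ (∑ l : Fin K, polygonVertex l ^ (2 * k)).re := by
    by_cases h : polygonVertex (1 : Fin K) ^ (2 * k) = 1
    · have hone (l : Fin K) : polygonVertex l ^ (2 * k) = 1 := by
        rw [← polygonVertex_one_pow, pow_right_comm, h, one_pow]
      simp [hone]
    · simp [sum_polygonVertex_pow h]
  calc (K : ℝ) / 2 ≤ K / 2 + (∑ l : Fin K, polygonVertex l ^ (2 * k)).re / 2 := by linarith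
    _ = ∑ l : Fin K, (polygonVertex l ^ k).re ^ 2 := by
      simp_rw [hsq]
      rw [Finset.sum_add_distrib, Complex.re_sum, Finset.sum_div]
      simp [div_eq_mul_inv]
    _ = ∑ j, cosKernel k i j ^ 2 :=
      ((Equiv.subLeft i).sum_comp fun l => (polygonVertex l ^ k).re ^ 2).symm

lemma integral_inner_pow_mul_cosKernel_sectorIndex {k m : ℕ} (hk : 2 * k ≤ K) (hm : m < k) (s : ℂ)
    (j : Fin K) :
    ∫ w, inner ℝ s w ^ m * cosKernel k (sectorIndex K w) j ∂stdGaussian ℂ = 0 := by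
  have hre (w : ℂ) : inner ℝ s w ^ m * cosKernel k (sectorIndex K w) j =
      ((inner ℝ s w : ℂ) ^ m * polygonVertex (sectorIndex K w) ^ k *
        polygonVertex (-j) ^ k).re := by
    rw [mul_assoc, ← mul_pow, ← polygonVertex_add, ← sub_eq_add_neg, ← Complex.ofReal_pow,
      Complex.re_ofReal_mul, cosKernel]
  have hint : Integrable (fun w => (inner ℝ s w : ℂ) ^ m * polygonVertex (sectorIndex K w) ^ k *
      polygonVertex (-j) ^ k) (stdGaussian ℂ) := by
    have := measurable_polygonVertex_sectorIndex (K := K)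
    refine (((integrable_norm_pow_stdGaussian m).const_mul (‖s‖ ^ m)).mono'
      (Measurable.aestronglyMeasurable (by fun_prop)) (.of_forall fun w => ?_)).mul_const _
    rw [norm_mul, norm_pow, norm_pow, norm_polygonVertex, one_pow, mul_one, Complex.norm_real,
      ← mul_pow]
    exact
      pow_le_pow_left₀ (abs_nonneg _) (abs_real_inner_le_norm s w) m
  simp_rw [hre]
  refine (integral_re hint).trans ?_
  rw [integral_mul_const, integral_inner_pow_mul_polygonVertex_sectorIndex_pow hk hm, zero_mul,
    map_zero]

end CosKernel

lemma exists_coprime_of_two_le {K : ℕ} (hK : 2 ≤ K) :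
    ∃ k : ℕ, 0 < k ∧ k.Coprime K ∧ 2 * k ≤ K ∧ K ≤ 6 * k := by
  suffices h : ∃ k r : ℕ, K = 2 * k + r ∧ k.Coprime r ∧ 0 < k ∧ r ≤ 4 * k by
    obtain ⟨k, r, rfl, hkr, hk, hr⟩ := h
    exact ⟨k, hk, (Nat.coprime_mul_right_add_right k r 2).mpr hkr, by omega, by omega⟩
  obtain h | h | h | h : K = 2 ∨ Odd K ∨ (∃ l, K = 4 * l + 4) ∨ ∃ l, K = 4 * l + 6 := by
    rcases Nat.even_or_odd' K with ⟨m, hm | hm⟩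
    · rcases Nat.even_or_odd' m with ⟨l, hl | hl⟩
      · exact .inr (.inr (.inl ⟨l - 1, by omega⟩))
      · rcases l.eq_zero_or_pos with rfl | hl'
        · exact .inl (by omega)
        · exact .inr (.inr (.inr ⟨l - 1, by omega⟩))
    · exact .inr (.inl ⟨m, hm⟩)
  · exact ⟨1, 0, by omega, by simp, by omega, by omega⟩
  · obtain ⟨k, rfl⟩ := h
    exact ⟨k, 1, rfl, Nat.coprime_one_right k, by omega, by omega⟩
  · obtain ⟨l, rfl⟩ := h
    exact ⟨2 * l + 1, 2, by omega, by simp, by omega, by omega⟩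
  · obtain ⟨l, rfl⟩ := h
    have hodd : (2 * l + 1).Coprime (2 ^ 2) := (Nat.coprime_two_right.mpr (by simp)).pow_right 2
    exact ⟨2 * l + 1, 4, by omega, hodd, by omega, by omega⟩

section SignVectors

variable {ι : Type*} [Fintype ι]

/-- The mean of the entries of a sign vector, so that `signMean (v * v')` is the normalized inner
product of the sign vectors `v` and `v'`. -/
noncomputable def signMean (v : ι → ℤˣ) : ℝ := (∑ i, ((v i : ℤ) : ℝ)) / Fintype.card ι

lemma signMean_one [Nonempty ι] : signMean (1 : ι → ℤˣ) = 1 := by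
  simp [signMean]

lemma signMean_neg (v : ι → ℤˣ) : signMean (-v) = -signMean v := by
  simp [signMean, neg_div]

variable [DecidableEq ι]

lemma sum_exp_mul_sum_sign (c : ℝ) :
    ∑ v : ι → ℤˣ, Real.exp (c * ∑ i, ((v i : ℤ) : ℝ)) = (2 * Real.cosh c) ^ Fintype.card ι := by
  have hfactor : ∑ u : ℤˣ, Real.exp (c * ((u : ℤ) : ℝ)) = 2 * Real.cosh c := by
    rw [UnitsInt.univ, Finset.sum_pair (by decide), Real.cosh_eq]
    simp
    ring
  simp_rw [Finset.mul_sum, Real.exp_sum]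
  rw [← Fintype.prod_sum fun _ (u : ℤˣ) => Real.exp (c * ((u : ℤ) : ℝ)), hfactor,
    Finset.prod_const, Finset.card_univ]

lemma card_lt_signMean_le {t : ℝ} (ht : 0 ≤ t) :
    (({v : ι → ℤˣ | t < signMean v} : Finset _).card : ℝ) ≤
      2 ^ Fintype.card ι * Real.exp (-(Fintype.card ι * t ^ 2 / 2)) := by
  set n := Fintype.card ι
  have hchernoff : (({v : ι → ℤˣ | t < signMean v} : Finset _).card : ℝ) *
      Real.exp (t * (n * t)) ≤ ∑ v : ι → ℤˣ, Real.exp (t * ∑ i, ((v i : ℤ) : ℝ)) := by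
    rw [← nsmul_eq_mul, ← Finset.sum_const]
    refine (Finset.sum_le_sum fun v hv => Real.exp_le_exp.mpr ?_).trans
      (Finset.sum_le_univ_sum_of_nonneg fun _ => Real.exp_nonneg _)
    have hlt : t < (∑ i, ((v i : ℤ) : ℝ)) / n := (Finset.mem_filter.mp hv).2
    have hn : (0 : ℝ) < n := by
      refine n.cast_nonneg.lt_of_ne' fun hn => ?_
      rw [hn, div_zero] at hlt
      exact hlt.not_ge ht
    gcongr
    exact ((lt_div_iff₀' hn).mp hlt).le
  rw [sum_exp_mul_sum_sign] at hchernoff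
  rw [show -(n * t ^ 2 / 2) = n * (t ^ 2 / 2) - t * (n * t) by ring, Real.exp_sub, ← mul_div_assoc,
    le_div_iff₀ (Real.exp_pos _)]
  calc _ ≤ (2 * Real.cosh t) ^ n := hchernoff
    _ ≤ (2 * Real.exp (t ^ 2 / 2)) ^ n := by gcongr; exact Real.cosh_le_exp_half_sq t
    _ = 2 ^ n * Real.exp (n * (t ^ 2 / 2)) := by rw [mul_pow, Real.exp_nat_mul]

lemma card_lt_abs_signMean_mul_le (v : ι → ℤˣ) {t : ℝ} (ht : 0 ≤ t) :
    (({v' | t < |signMean (v * v')|} : Finset (ι → ℤˣ)).card : ℝ) ≤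
      2 * Real.exp (-(Fintype.card ι * t ^ 2 / 2)) * Fintype.card (ι → ℤˣ) := by
  have hshift : ({v' | t < |signMean (v * v')|} : Finset (ι → ℤˣ)).card =
      ({u | t < |signMean u|} : Finset (ι → ℤˣ)).card :=
    Finset.card_equiv (Equiv.mulLeft v) (by simp)
  have hneg : ({u | t < -signMean u} : Finset (ι → ℤˣ)).card =
      ({u | t < signMean u} : Finset (ι → ℤˣ)).card :=
    Finset.card_equiv (Equiv.neg _) (by simp [signMean_neg])
  have hunion : ({u | t < |signMean u|} : Finset (ι → ℤˣ)).card ≤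
      ({u | t < signMean u} : Finset (ι → ℤˣ)).card +
        ({u | t < -signMean u} : Finset (ι → ℤˣ)).card := by
    simp_rw [lt_abs, Finset.filter_or]
    exact Finset.card_union_le _ _
  have htail := card_lt_signMean_le (ι := ι) ht
  have hcard : (Fintype.card (ι → ℤˣ) : ℝ) = 2 ^ Fintype.card ι := by simp
  rw [hneg] at hunion
  rw [hshift, hcard]
  calc _ ≤ ((_ + _ : ℕ) : ℝ) := Nat.cast_le.mpr hunion
    _ ≤ _ := by push_cast; linarith

end SignVectors

section HiddenPlane

variable {ι F E : Type*} [Fintype ι] [NormedAddCommGroup F] [InnerProductSpace ℝ F]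
  [NormedAddCommGroup E] [InnerProductSpace ℝ E]

lemma exists_linearIsometry_of_finrank_le [FiniteDimensional ℝ F] [FiniteDimensional ℝ E]
    (h : Module.finrank ℝ F ≤ Module.finrank ℝ E) : Nonempty (F →ₗᵢ[ℝ] E) := by
  have b := stdOrthonormalBasis ℝ F
  have c := stdOrthonormalBasis ℝ E
  refine ⟨(b.toBasis.constr ℝ (c ∘ Fin.castLE h)).isometryOfOrthonormal (v := b.toBasis)
    (by simp) ?_⟩
  have hcomp : b.toBasis.constr ℝ (c ∘ Fin.castLE h) ∘ b.toBasis = c ∘ Fin.castLE h :=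
    funext fun i => b.toBasis.constr_basis ..
  rw [hcomp]
  exact c.orthonormal.comp _ (Fin.castLE_injective h)

lemma exists_linearIsometry_inner_eq_signMean_mul [Nonempty ι] [FiniteDimensional ℝ F]
    [FiniteDimensional ℝ E] (h : Fintype.card ι * Module.finrank ℝ F ≤ Module.finrank ℝ E) :
    ∃ U : (ι → ℤˣ) → F →ₗᵢ[ℝ] E, ∀ v v' p q,
      inner ℝ (U v p) (U v' q) = signMean (v * v') * inner ℝ p q := by
  obtain ⟨J⟩ : Nonempty ((PiLp 2 fun _ : ι => F) →ₗᵢ[ℝ] E) :=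
    exists_linearIsometry_of_finrank_le (by
      simpa [(WithLp.linearEquiv 2 ℝ (ι → F)).finrank_eq, Module.finrank_pi_fintype] using h)
  let scale (v : ι → ℤˣ) : F →ₗ[ℝ] PiLp 2 fun _ : ι => F :=
    (WithLp.linearEquiv 2 ℝ (ι → F)).symm.toLinearMap ∘ₗ
      LinearMap.pi fun i => (((v i : ℤ) : ℝ) / √(Fintype.card ι)) • LinearMap.id
  have hscale (v v' : ι → ℤˣ) (p q : F) :
      inner ℝ (scale v p) (scale v' q) = signMean (v * v') * inner ℝ p q := by
    simp only [scale, PiLp.inner_apply, signMean, Finset.sum_div, Finset.sum_mul]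
    refine Finset.sum_congr rfl fun i _ => ?_
    have hratio : (((v i : ℤ) : ℝ) / √(Fintype.card ι)) * (((v' i : ℤ) : ℝ) / √(Fintype.card ι)) =
        (((v * v') i : ℤ) : ℝ) / Fintype.card ι := by
      rw [div_mul_div_comm, Real.mul_self_sqrt (Nat.cast_nonneg _)]
      simp
    rw [← hratio, mul_assoc, ← real_inner_smul_right, ← real_inner_smul_left]
    rfl
  refine ⟨fun v => J.comp ((scale v).isometryOfInner fun p q => ?_), fun v v' p q => ?_⟩
  · rw [hscale, ← sq, show v ^ 2 = 1 from funext fun i => Int.units_sq _, signMean_one, one_mul]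
  · simpa using hscale v v' p q

end HiddenPlane

section Correlation

variable {V E : Type*} [NormedAddCommGroup E] [InnerProductSpace ℝ E]

lemma sq_sum_abs_inner_le (g : V → E) (q : E) (B : Finset V) :
    (∑ v ∈ B, |inner ℝ q (g v)|) ^ 2 ≤
      ‖q‖ ^ 2 * ∑ v ∈ B, ∑ v' ∈ B, |inner ℝ (g v) (g v')| := by
  set s : V → ℝ := fun v => SignType.sign (inner ℝ q (g v))
  have abs_s_le (v : V) : |s v| ≤ 1 := by
    rcases lt_trichotomy (inner ℝ q (g v)) 0 with h | h | h <;> simp [s, h]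
  have sum_abs_eq : ∑ v ∈ B, |inner ℝ q (g v)| = inner ℝ q (∑ v ∈ B, s v • g v) := by
    simp only [inner_sum, real_inner_smul_right, s, sign_mul_self]
  have norm_sq_le : ‖∑ v ∈ B, s v • g v‖ ^ 2 ≤ ∑ v ∈ B, ∑ v' ∈ B, |inner ℝ (g v) (g v')| := by
    rw [← real_inner_self_eq_norm_sq]
    simp only [sum_inner, inner_sum, real_inner_smul_left, real_inner_smul_right]
    refine Finset.sum_le_sum fun v _ => Finset.sum_le_sum fun v' _ => (le_abs_self _).trans ?_
    rw [abs_mul, abs_mul]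
    exact (mul_le_of_le_one_left (by positivity) (abs_s_le v)).trans
      ((real_inner_comm (g v) (g v')) ▸ mul_le_of_le_one_left (abs_nonneg _) (abs_s_le v'))
  calc (∑ v ∈ B, |inner ℝ q (g v)|) ^ 2
      ≤ (‖q‖ * ‖∑ v ∈ B, s v • g v‖) ^ 2 := by
        rw [sum_abs_eq, sq_le_sq, abs_of_nonneg (by positivity : 0 ≤ ‖q‖ * _)]
        exact abs_real_inner_le_norm _ _
    _ ≤ _ := by rw [mul_pow]; gcongr

variable [Fintype V]

open Classical in
lemma card_lt_sq_inner_le {g : V → E} {ε δ τ : ℝ} (hg : ∀ v, ‖g v‖ ≤ 1) (hε : 0 ≤ ε)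
    (hδ : 0 ≤ δ) (hτ : 0 < τ)
    (hcorr : ∀ v, (Finset.card {v' | ε < |inner ℝ (g v) (g v')|} : ℝ) ≤ δ * Fintype.card V)
    (q : E) :
    (Finset.card {v | (ε + δ / τ) * ‖q‖ ^ 2 < inner ℝ q (g v) ^ 2} : ℝ) ≤
      τ * Fintype.card V := by
  by_contra! hcard
  set B : Finset V := {v | (ε + δ / τ) * ‖q‖ ^ 2 < inner ℝ q (g v) ^ 2} with hB
  have hBpos : (0 : ℝ) < B.card := lt_of_le_of_lt (by positivity) hcard
  have row_le (v : V) : ∑ v' ∈ B, |inner ℝ (g v) (g v')| ≤ (ε + δ / τ) * B.card := by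
    calc ∑ v' ∈ B, |inner ℝ (g v) (g v')|
        ≤ ∑ v' ∈ B, (ε + if ε < |inner ℝ (g v) (g v')| then 1 else 0) := by
          refine Finset.sum_le_sum fun v' _ => ?_
          split_ifs with h
          · have := (abs_real_inner_le_norm (g v) (g v')).trans
              (mul_le_one₀ (hg v) (norm_nonneg _) (hg v'))
            linarith
          · linarith
      _ ≤ ε * B.card + ∑ v', (if ε < |inner ℝ (g v) (g v')| then (1 : ℝ) else 0) := by
          rw [Finset.sum_add_distrib, Finset.sum_const, nsmul_eq_mul, mul_comm]
          gcongr
          exact Finset.subset_univ _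
      _ ≤ ε * B.card + δ / τ * (τ * Fintype.card V) := by
          rw [Finset.sum_boole, ← mul_assoc, div_mul_cancel₀ _ hτ.ne']
          gcongr
          exact hcorr v
      _ ≤ (ε + δ / τ) * B.card := by rw [add_mul]; gcongr
  have upper : (∑ v ∈ B, |inner ℝ q (g v)|) ^ 2 ≤ ‖q‖ ^ 2 * ((ε + δ / τ) * B.card ^ 2) := by
    refine (sq_sum_abs_inner_le g q B).trans ?_
    gcongr
    refine (Finset.sum_le_sum fun v _ => row_le v).trans_eq ?_
    rw [Finset.sum_const, nsmul_eq_mul]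
    ring
  have lower : B.card * √((ε + δ / τ) * ‖q‖ ^ 2) < ∑ v ∈ B, |inner ℝ q (g v)| := by
    rw [← nsmul_eq_mul, ← Finset.sum_const]
    refine Finset.sum_lt_sum_of_nonempty (Finset.card_pos.mp (by exact_mod_cast hBpos)) ?_
    intro v hv
    rw [← Real.sqrt_sq_eq_abs]
    exact Real.sqrt_lt_sqrt (by positivity) (Finset.mem_filter.mp hv).2
  have := pow_lt_pow_left₀ lower (by positivity) two_ne_zero
  rw [mul_pow, Real.sq_sqrt (by positivity)] at this
  linarith

end Correlation

lemma card_filter_le_card_filter_add {V : Type*} [Fintype V] {p q r : V → Prop}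
    [DecidablePred p] [DecidablePred q] [DecidablePred r] (h : ∀ v, p v → q v ∨ r v) :
    (Finset.card {v | p v} : ℝ) ≤ Finset.card {v | q v} + Finset.card {v | r v} := by
  rw [← Nat.cast_add, Nat.cast_le]
  refine (Finset.card_le_card (Finset.monotone_filter_right _ fun v _ => h v)).trans ?_
  classical
  rw [Finset.filter_or]
  exact Finset.card_union_le _ _

section VSTAT

variable {X : Type*} [MeasurableSpace X]

/-- `a` is an answer that `VSTAT(u)` may give to the query `q` under the distribution `D`. -/
def IsVSTATAnswer (D : Measure X) (q : StatQuery X) (u a : ℝ) : Prop :=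
  |a - ∫ x, q.toFun x ∂D| ≤ max (1 / u) (√(variance q.toFun D / u))

variable {P₀ : Measure X}

lemma integral_withDensity_one_sub {g : X → ℝ} (hg : Measurable g) (hg1 : ∀ x, |g x| ≤ 1)
    {f : X → ℝ} (hf : Integrable f P₀) :
    ∫ x, f x ∂P₀.withDensity (fun x => ENNReal.ofReal (1 - g x)) =
      ∫ x, f x ∂P₀ - ∫ x, f x * g x ∂P₀ := by
  have hfg : Integrable (fun x => f x * g x) P₀ :=
    hf.mul_bdd hg.aestronglyMeasurable (.of_forall hg1)
  rw [integral_withDensity_eq_integral_toReal_smul (by fun_prop) (by simp), ← integral_sub hf hfg]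
  refine integral_congr_ae (.of_forall fun x => ?_)
  have := (abs_le.mp (hg1 x)).2
  simp only [smul_eq_mul]
  rw [ENNReal.toReal_ofReal (by linarith)]
  ring

lemma StatQuery.integrable (q : StatQuery X) (P : Measure X) [IsFiniteMeasure P] :
    Integrable q.toFun P :=
  .of_bound q.measurable_toFun.aestronglyMeasurable 1
    (.of_forall fun x => abs_le.mpr (q.mem_Icc x))

variable [IsProbabilityMeasure P₀]

lemma StatQuery.abs_sub_integral_le (q : StatQuery X) (x : X) :
    |q.toFun x - ∫ y, q.toFun y ∂P₀| ≤ 2 := by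
  have h : |∫ y, q.toFun y ∂P₀| ≤ 1 := by
    simpa using norm_integral_le_of_norm_le_const (μ := P₀) (f := q.toFun) (C := 1)
      (.of_forall fun x => abs_le.mpr (q.mem_Icc x))
  linarith [abs_sub (q.toFun x) (∫ y, q.toFun y ∂P₀), abs_le.mpr (q.mem_Icc x)]

variable {g : X → ℝ} {P : Measure X} [IsProbabilityMeasure P] {q : StatQuery X}

lemma integral_toFun_of_eq_withDensity (hg : Measurable g) (hg1 : ∀ x, |g x| ≤ 1)
    (hP : P = P₀.withDensity fun x => ENNReal.ofReal (1 - g x)) (m : ℝ) :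
    ∫ x, q.toFun x ∂P = ∫ x, q.toFun x ∂P₀ - ∫ x, (q.toFun x - m) * g x ∂P₀ := by
  have h := integral_withDensity_one_sub (P₀ := P₀) hg hg1
    ((q.integrable P₀).sub (integrable_const m))
  simp only [← hP, Pi.sub_apply] at h
  rw [integral_sub (q.integrable P) (integrable_const m),
    integral_sub (q.integrable P₀) (integrable_const m)] at h
  simp only [integral_const, probReal_univ, one_smul] at h
  linarith

lemma integrable_sub_sq (q : StatQuery X) (m : ℝ) :
    Integrable (fun x => (q.toFun x - m) ^ 2) P₀ :=
  (((memLp_top_of_bound q.measurable_toFun.aestronglyMeasurable 1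
    (.of_forall fun x => abs_le.mpr (q.mem_Icc x))).mono_exponent le_top).sub
      (memLp_const m)).integrable_sq

lemma variance_toFun_of_eq_withDensity (hg : Measurable g) (hg1 : ∀ x, |g x| ≤ 1)
    (hP : P = P₀.withDensity fun x => ENNReal.ofReal (1 - g x)) {m : ℝ}
    (hm : ∫ x, q.toFun x ∂P₀ = m) :
    variance q.toFun P = ∫ x, (q.toFun x - m) ^ 2 ∂P₀ - ∫ x, (q.toFun x - m) ^ 2 * g x ∂P₀ -
      (∫ x, (q.toFun x - m) * g x ∂P₀) ^ 2 := by
  have hqm : Measurable q.toFun := q.measurable_toFun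
  have hLp : MemLp (fun x => q.toFun x - m) 2 P :=
    (memLp_two_iff_integrable_sq (by fun_prop)).mpr (integrable_sub_sq q m)
  rw [← variance_sub_const hqm.aestronglyMeasurable m, variance_eq_sub hLp,
    integral_sub (q.integrable P) (integrable_const m),
    integral_toFun_of_eq_withDensity hg hg1 hP m, hm, hP]
  simp only [Pi.pow_apply]
  rw [integral_withDensity_one_sub hg hg1 (integrable_sub_sq q m)]
  simp [← hP]

/-- Either the variance of `q` is at least `16 ε` under `P₀`, and then it drops by at most half
under `P`, or it is so small that the answer has error at most `1 / u`. -/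
lemma isVSTATAnswer_integral_of_sq_integral_mul_le (hg : Measurable g) (hg1 : ∀ x, |g x| ≤ 1)
    (hP : P = P₀.withDensity fun x => ENNReal.ofReal (1 - g x)) {m u ε : ℝ}
    (hm : ∫ x, q.toFun x ∂P₀ = m) (hu : 0 < u) (hε : 0 ≤ ε) (huε : 16 * (u + 1) * ε ≤ 1)
    (h₁ : (∫ x, (q.toFun x - m) * g x ∂P₀) ^ 2 ≤ ε * ∫ x, (q.toFun x - m) ^ 2 ∂P₀)
    (h₂ : (∫ x, (q.toFun x - m) ^ 2 * g x ∂P₀) ^ 2 ≤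
      ε * ∫ x, ((q.toFun x - m) ^ 2) ^ 2 ∂P₀) :
    IsVSTATAnswer P q u m := by
  have var := variance_toFun_of_eq_withDensity hg hg1 hP hm
  rw [IsVSTATAnswer, integral_toFun_of_eq_withDensity hg hg1 hP m, hm, sub_sub_cancel]
  set Δ := ∫ x, (q.toFun x - m) * g x ∂P₀
  set Δ' := ∫ x, (q.toFun x - m) ^ 2 * g x ∂P₀
  set S := ∫ x, (q.toFun x - m) ^ 2 ∂P₀
  have hS0 : 0 ≤ S := integral_nonneg fun x => sq_nonneg _
  have fourth : ∫ x, ((q.toFun x - m) ^ 2) ^ 2 ∂P₀ ≤ 4 * S := by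
    rw [← integral_const_mul]
    refine integral_mono_of_nonneg (.of_forall fun x => by positivity)
      ((integrable_sub_sq q m).const_mul 4) (.of_forall fun x => ?_)
    have bound : |q.toFun x - m| ≤ 2 := hm ▸ q.abs_sub_integral_le x
    have bound_sq : (q.toFun x - m) ^ 2 ≤ 4 := by
      nlinarith [sq_abs (q.toFun x - m), abs_nonneg (q.toFun x - m)]
    nlinarith [sq_nonneg (q.toFun x - m)]
  rcases lt_or_ge S (16 * ε) with hS | hS
  · refine le_max_of_le_left ?_
    have : |Δ| ≤ 4 * ε := abs_le_of_sq_le_sq (by nlinarith) (by positivity)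
    rw [le_div_iff₀ hu]
    nlinarith
  · refine le_max_of_le_right (Real.abs_le_sqrt ?_)
    have : |Δ'| ≤ S / 2 := abs_le_of_sq_le_sq (by nlinarith) (by positivity)
    rw [le_div_iff₀ hu, var]
    nlinarith [le_abs_self Δ', mul_le_mul_of_nonneg_right huε hS0]

variable {V : Type*} [Fintype V] {G : V → X → ℝ} {Q : V → Measure X} {ε δ τ : ℝ}

open Classical in
lemma card_lt_sq_integral_mul_le (hG : ∀ v, Measurable (G v)) (hG1 : ∀ v x, |G v x| ≤ 1)
    (hε : 0 ≤ ε) (hδ : 0 ≤ δ) (hτ : 0 < τ)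
    (hcorr : ∀ v, (Finset.card {v' | ε < |∫ x, G v x * G v' x ∂P₀|} : ℝ) ≤ δ * Fintype.card V)
    {f : X → ℝ} (hf : MemLp f 2 P₀) :
    (Finset.card {v | (ε + δ / τ) * ∫ x, f x ^ 2 ∂P₀ < (∫ x, f x * G v x ∂P₀) ^ 2} : ℝ) ≤
      τ * Fintype.card V := by
  have hG2 (v : V) : MemLp (G v) 2 P₀ :=
    .of_bound (hG v).aestronglyMeasurable 1 (.of_forall (hG1 v))
  have inner_toLp {f g : X → ℝ} (hf : MemLp f 2 P₀) (hg : MemLp g 2 P₀) :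
      inner ℝ hf.toLp hg.toLp = ∫ x, f x * g x ∂P₀ := by
    rw [L2.inner_def]
    refine integral_congr_ae ?_
    filter_upwards [hf.coeFn_toLp, hg.coeFn_toLp] with x hfx hgx
    rw [hfx, hgx, RCLike.inner_apply, conj_trivial, mul_comm]
  have norm_toLp_le (v : V) : ‖(hG2 v).toLp‖ ≤ 1 := by
    simpa [measureUnivNNReal] using Lp.norm_le_of_ae_bound (f := (hG2 v).toLp) zero_le_one
      ((hG2 v).coeFn_toLp.mono fun x hx => by rw [hx]; exact hG1 v x)
  have := card_lt_sq_inner_le norm_toLp_le hε hδ hτ (by simpa only [inner_toLp] using hcorr)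
    hf.toLp
  simpa only [← real_inner_self_eq_norm_sq, inner_toLp, ← pow_two] using this

open Classical in
lemma card_not_isVSTATAnswer_le (hG : ∀ v, Measurable (G v)) (hG1 : ∀ v x, |G v x| ≤ 1)
    [∀ v, IsProbabilityMeasure (Q v)]
    (hQ : ∀ v, Q v = P₀.withDensity fun x => ENNReal.ofReal (1 - G v x))
    (hε : 0 ≤ ε) (hδ : 0 ≤ δ) (hτ : 0 < τ)
    (hcorr : ∀ v, (Finset.card {v' | ε < |∫ x, G v x * G v' x ∂P₀|} : ℝ) ≤ δ * Fintype.card V)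
    (q : StatQuery X) {u : ℝ} (hu : 0 < u) (huε : 16 * (u + 1) * (ε + δ / τ) ≤ 1) :
    (Finset.card {v | ¬ IsVSTATAnswer (Q v) q u (∫ x, q.toFun x ∂P₀)} : ℝ) ≤
      2 * τ * Fintype.card V := by
  set m := ∫ x, q.toFun x ∂P₀
  have hq : MemLp (fun x => q.toFun x - m) ∞ P₀ :=
    memLp_top_of_bound (q.measurable_toFun.sub_const m).aestronglyMeasurable 2
      (.of_forall q.abs_sub_integral_le)
  have hq2 : MemLp (fun x => (q.toFun x - m) ^ 2) ∞ P₀ := by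
    simpa only [pow_two] using hq.mul' hq
  have h₁ := card_lt_sq_integral_mul_le hG hG1 hε hδ hτ hcorr (hq.mono_exponent le_top)
  have h₂ := card_lt_sq_integral_mul_le hG hG1 hε hδ hτ hcorr (hq2.mono_exponent le_top)
  refine (card_filter_le_card_filter_add fun v hv => ?_).trans (add_le_add h₁ h₂) |>.trans_eq
    (by rw [mul_assoc, two_mul])
  by_contra! h
  exact hv (isVSTATAnswer_integral_of_sq_integral_mul_le (hG v) (hG1 v) (hQ v) rfl hu
    (by positivity) huε h.1 h.2)

open Classical in
/-- The oracle for `D` that answers with expectations under `P₀` whenever this is valid. -/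
noncomputable def referenceOracle (P₀ D : Measure X) : SQOracle X := fun q u =>
  if IsVSTATAnswer D q u (∫ x, q.toFun x ∂P₀) then ∫ x, q.toFun x ∂P₀ else ∫ x, q.toFun x ∂D

lemma isVSTAT_referenceOracle (P₀ D : Measure X) : IsVSTAT D (referenceOracle P₀ D) := by
  intro q u
  rw [referenceOracle]
  split_ifs with h
  · exact h
  · rw [sub_self, abs_zero]
    exact le_max_of_le_left (one_div_nonneg.mpr u.2.le)

end VSTAT

section Simulation

variable {X : Type*} [MeasurableSpace X] {V H Ω : Type*} [Fintype V]

open Classical in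
lemma SQAlgorithm.card_run_ne_le {O : SQOracle X} {O' : V → SQOracle X} {U b : ℝ} (hb : 0 ≤ b)
    (hO : ∀ q (u : {u : ℝ // 0 < u}), (u : ℝ) < U →
      (Finset.card {v | O' v q u ≠ O q u} : ℝ) ≤ b)
    (a : SQAlgorithm X H) (M : ℕ) :
    (Finset.card {v | (a.queries (O' v)).length ≤ M ∧ (∀ p ∈ a.queries (O' v), (p.2 : ℝ) < U) ∧
      a.run (O' v) ≠ a.run O} : ℝ) ≤ M * b := by
  induction a generalizing M with
  | output h => simpa [run] using by positivity
  | query q u next ih =>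
    cases M with
    | zero => simp [queries]
    | succ M =>
      by_cases hu : (u : ℝ) < U
      · calc _ ≤ (Finset.card {v | O' v q u ≠ O q u} : ℝ) + Finset.card {v |
              ((next (O q u)).queries (O' v)).length ≤ M ∧
                (∀ p ∈ (next (O q u)).queries (O' v), (p.2 : ℝ) < U) ∧
                  (next (O q u)).run (O' v) ≠ (next (O q u)).run O} := by
              refine card_filter_le_card_filter_add fun v hv => ?_
              by_cases hv' : O' v q u = O q u
              · simp only [queries, run, hv', List.length_cons, add_le_add_iff_right,
                  List.forall_mem_cons] at hv
                exact .inr ⟨hv.1, hv.2.1.2, hv.2.2⟩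
              · exact .inl hv'
          _ ≤ b + M * b := add_le_add (hO q u hu) (ih (O q u) M)
          _ = _ := by push_cast; ring
      · simpa [queries, hu] using by positivity

variable [MeasurableSpace Ω] {μ : Measure Ω} [IsProbabilityMeasure μ]

open Classical in
lemma exists_mul_card_le_card_mem {G : V → Set Ω} (hG : ∀ v, NullMeasurableSet (G v) μ) {c : ℝ≥0∞}
    (hc : ∀ v, c ≤ μ (G v)) : ∃ ω, c * Fintype.card V ≤ Finset.card {v | ω ∈ G v} := by
  have lintegral_card : c * Fintype.card V ≤ ∫⁻ ω, (Finset.card {v | ω ∈ G v} : ℝ≥0∞) ∂μ := by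
    calc c * Fintype.card V = ∑ _v : V, c := by simp [mul_comm]
      _ ≤ ∑ v, ∫⁻ ω, (G v).indicator 1 ω ∂μ := by
        gcongr with v
        rw [lintegral_indicator_one₀ (hG v)]
        exact hc v
      _ = ∫⁻ ω, ∑ v, (G v).indicator 1 ω ∂μ :=
        (lintegral_finsetSum' _ fun v _ => aemeasurable_one.indicator₀ (hG v)).symm
      _ = _ := by simp [Set.indicator_apply, Finset.sum_boole]
  have lintegral_ne_top : ∫⁻ ω, (Finset.card {v | ω ∈ G v} : ℝ≥0∞) ∂μ ≠ ∞ := by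
    refine ne_top_of_le_ne_top (ENNReal.natCast_ne_top (Fintype.card V)) ?_
    simpa using lintegral_mono (μ := μ) fun ω =>
      Nat.cast_le (α := ℝ≥0∞).mpr (Finset.card_le_univ {v | ω ∈ G v})
  exact (exists_lintegral_le lintegral_ne_top).imp fun ω => lintegral_card.trans

open Classical in
/-- Against the oracles that answer with expectations under `P₀`, the algorithm cannot tell most of
the distributions `P v` apart, so that it proposes the same output for many of them. -/
theorem exists_isVSTAT_measure_pos {P₀ : Measure X} {P : V → Measure X} {δ N U : ℝ}
    (hδ : 0 ≤ δ) (hN : ⌊N⌋₊ * δ ≤ 1 / 6)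
    (hvalid : ∀ (q : StatQuery X) (u : ℝ), 0 < u → u < U →
      (Finset.card {v | ¬ IsVSTATAnswer (P v) q u (∫ x, q.toFun x ∂P₀)} : ℝ) ≤
        δ * Fintype.card V)
    {R : V → H → Prop} [∀ h, DecidablePred (R · h)]
    (hR : ∀ h, (Finset.card {v | R v h} : ℝ) < Fintype.card V / 2)
    (A : Ω → SQAlgorithm X H)
    (hA : ∀ v O, IsVSTAT (P v) O → ∃ G : Set Ω, MeasurableSet G ∧ (2 / 3 : ℝ≥0∞) ≤ μ G ∧
      ∀ ω ∈ G, R v ((A ω).run O)) :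
    ∃ v O, IsVSTAT (P v) O ∧ 0 < μ {ω | N ≤ (((A ω).queries O).length : ℝ) ∨
      ∃ p ∈ (A ω).queries O, U ≤ (p.2 : ℝ)} := by
  by_contra! hcheap
  set O : V → SQOracle X := fun v => referenceOracle P₀ (P v)
  have hO (v : V) : IsVSTAT (P v) (O v) := isVSTAT_referenceOracle P₀ (P v)
  choose G hGm hG hGR using fun v => hA v (O v) (hO v)
  set Z : V → Set Ω := fun v => {ω | N ≤ (((A ω).queries (O v)).length : ℝ) ∨
    ∃ p ∈ (A ω).queries (O v), U ≤ (p.2 : ℝ)}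
  have hZ (v : V) : μ (Z v) = 0 := nonpos_iff_eq_zero.mp (hcheap v (O v) (hO v))
  obtain ⟨ω, hω⟩ := exists_mul_card_le_card_mem (c := 2 / 3) (G := fun v => G v \ Z v)
    (fun v => (hGm v).nullMeasurableSet.diff (.of_null (hZ v)))
    (fun v => (measure_sdiff_null (hZ v)).symm ▸ hG v)
  have many_good : 2 / 3 * (Fintype.card V : ℝ) ≤ Finset.card {v | ω ∈ G v \ Z v} := by
    simpa [ENNReal.toReal_mul, ENNReal.toReal_div] using
      ENNReal.toReal_mono (ENNReal.natCast_ne_top _) hω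
  set O₀ : SQOracle X := fun q _ => ∫ x, q.toFun x ∂P₀
  have few_differ :=
    SQAlgorithm.card_run_ne_le (O := O₀) (O' := O) (U := U)
    (b := δ * Fintype.card V) (by positivity)
    (fun q u hu => (Nat.cast_le.mpr <| Finset.card_le_card <| Finset.monotone_filter_right _
      fun v _ hv h => hv (if_pos h)).trans (hvalid q u u.2 hu)) (A ω) ⌊N⌋₊
  have good_or_differ := card_filter_le_card_filter_add (p := fun v => ω ∈ G v \ Z v)
    (q := fun v => R v ((A ω).run O₀)) (r := fun v => ((A ω).queries (O v)).length ≤ ⌊N⌋₊ ∧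
      (∀ p ∈ (A ω).queries (O v), (p.2 : ℝ) < U) ∧ (A ω).run (O v) ≠ (A ω).run O₀) fun v hv => by
    simp only [Set.mem_sdiff, Z, Set.mem_ofPred_eq, not_or, not_le, not_exists, not_and] at hv
    by_cases hrun : (A ω).run (O v) = (A ω).run O₀
    · exact .inl (hrun ▸ hGR v ω hv.1)
    · exact .inr ⟨Nat.le_floor hv.2.1.le, hv.2.2, hrun⟩
  have := mul_le_mul_of_nonneg_right hN (Nat.cast_nonneg (α := ℝ) (Fintype.card V))
  linarith [hR ((A ω).run O₀)]

end Simulation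

section LabelMeasure

variable {X T : Type*} [MeasurableSpace X] [MeasurableSpace T] {μ : Measure X} {h : X → T → ℝ}

/-- The law of a pair `(x, t)` where `x` has law `μ` and, given `x`, the label `t` has probability
`h x t`. -/
noncomputable def labelMeasure (μ : Measure X) (h : X → T → ℝ) : Measure (X × T) :=
  (μ.prod .count).withDensity fun p => ENNReal.ofReal (h p.1 p.2)

variable [Countable T] [MeasurableSingletonClass T]

lemma measurable_ofReal_uncurry (hh : ∀ t, Measurable fun x => h x t) :
    Measurable fun p : X × T => ENNReal.ofReal (h p.1 p.2) :=
  (measurable_from_prod_countable_left (f := fun p : X × T => h p.1 p.2) hh).ennreal_ofReal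

lemma labelMeasure_mul_eq_withDensity (hh : ∀ t, Measurable fun x => h x t) (h0 : ∀ x t, 0 ≤ h x t)
    {g : X × T → ℝ} (hg : Measurable g) :
    labelMeasure μ (fun x t => h x t * g (x, t)) =
      (labelMeasure μ h).withDensity fun p => ENNReal.ofReal (g p) := by
  rw [labelMeasure, labelMeasure,
    ← withDensity_mul _ (measurable_ofReal_uncurry hh) hg.ennreal_ofReal]
  exact congrArg _ (funext fun p => ENNReal.ofReal_mul (h0 p.1 p.2))

lemma lintegral_labelMeasure (hh : ∀ t, Measurable fun x => h x t) {g : X × T → ℝ≥0∞}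
    (hg : Measurable g) :
    ∫⁻ p, g p ∂labelMeasure μ h = ∫⁻ x, ∑' t, ENNReal.ofReal (h x t) * g (x, t) ∂μ := by
  have hm := measurable_ofReal_uncurry hh
  rw [labelMeasure, lintegral_withDensity_eq_lintegral_mul _ hm hg,
    lintegral_prod _ (hm.mul hg).aemeasurable]
  simp only [Pi.mul_apply, lintegral_count]

lemma labelMeasure_prod_singleton (hh : ∀ t, Measurable fun x => h x t) {A : Set X}
    (hA : MeasurableSet A) (t : T) :
    labelMeasure μ h (A ×ˢ {t}) = ∫⁻ x in A, ENNReal.ofReal (h x t) ∂μ := by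
  classical
  have hAt := hA.prod (measurableSet_singleton t)
  rw [← lintegral_indicator_one hAt, lintegral_labelMeasure hh (measurable_one.indicator hAt),
    ← lintegral_indicator hA]
  congr with x
  by_cases hx : x ∈ A <;> simp [Set.indicator_apply, hx]

variable [Fintype T]

lemma map_fst_labelMeasure (hh : ∀ t, Measurable fun x => h x t) (h0 : ∀ x t, 0 ≤ h x t)
    (h1 : ∀ x, ∑ t, h x t = 1) : (labelMeasure μ h).map Prod.fst = μ := by
  ext A hA
  rw [← lintegral_indicator_one hA, lintegral_map (measurable_one.indicator hA) measurable_fst,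
    lintegral_labelMeasure hh (g := fun p => A.indicator 1 p.1)
      ((measurable_one.indicator hA).comp measurable_fst),
    ← lintegral_indicator_one hA]
  simp_rw [tsum_fintype, ← Finset.sum_mul, ← ENNReal.ofReal_sum_of_nonneg fun t _ => h0 _ t, h1,
    ENNReal.ofReal_one, one_mul]

lemma isProbabilityMeasure_labelMeasure [IsProbabilityMeasure μ]
    (hh : ∀ t, Measurable fun x => h x t) (h0 : ∀ x t, 0 ≤ h x t) (h1 : ∀ x, ∑ t, h x t = 1) :
    IsProbabilityMeasure (labelMeasure μ h) :=
  have : IsProbabilityMeasure ((labelMeasure μ h).map Prod.fst) := by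
    rwa [map_fst_labelMeasure hh h0 h1]
  Measure.isProbabilityMeasure_of_map Prod.fst

lemma integral_labelMeasure [SFinite μ] (hh : ∀ t, Measurable fun x => h x t)
    (h0 : ∀ x t, 0 ≤ h x t)
    {q : X × T → ℝ} (hq : Integrable q (labelMeasure μ h)) :
    ∫ p, q p ∂labelMeasure μ h = ∫ x, ∑ t, h x t * q (x, t) ∂μ := by
  have hm := measurable_ofReal_uncurry hh
  rw [labelMeasure, integrable_withDensity_iff_integrable_smul' hm (by simp)] at hq
  rw [labelMeasure, integral_withDensity_eq_integral_toReal_smul hm (by simp), integral_prod _ hq]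
  simp [integral_countable, ENNReal.toReal_ofReal (h0 _ _)]

end LabelMeasure

section ExcludedLabel

variable {ι : Type*} [Fintype ι] [DecidableEq ι]

/-- A function `a` of the excluded label, as a function of the label set: its value at the
complement of `{j}` is `a j`, and it vanishes at the sets that are not of this form. -/
noncomputable def ofExcluded (a : ι → ℝ) : Finset ι → ℝ := Function.extend (fun j => {j}ᶜ) a 0

lemma compl_singleton_injective : Function.Injective fun j : ι => ({j}ᶜ : Finset ι) :=
  compl_injective.comp Finset.singleton_injective

@[simp]
lemma ofExcluded_compl_singleton (a : ι → ℝ) (j : ι) : ofExcluded a {j}ᶜ = a j :=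
  compl_singleton_injective.extend_apply a 0 j

lemma ofExcluded_of_forall_ne (a : ι → ℝ) {S : Finset ι} (hS : ∀ j, {j}ᶜ ≠ S) :
    ofExcluded a S = 0 :=
  Function.extend_apply' _ _ _ (not_exists.mpr hS)

lemma ofExcluded_of_card_add_one_ne (a : ι → ℝ) {S : Finset ι} (hS : S.card + 1 ≠ Fintype.card ι) :
    ofExcluded a S = 0 := by
  refine ofExcluded_of_forall_ne a fun j hj => hS ?_
  rw [← hj, ← Finset.card_singleton j, Finset.card_compl_add_card]

lemma ofExcluded_nonneg {a : ι → ℝ} (ha : ∀ j, 0 ≤ a j) (S : Finset ι) : 0 ≤ ofExcluded a S := by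
  by_cases hS : ∃ j, {j}ᶜ = S
  · obtain ⟨j, rfl⟩ := hS
    simpa only [ofExcluded_compl_singleton] using ha j
  · rw [ofExcluded_of_forall_ne a (not_exists.mp hS)]

lemma abs_ofExcluded_le_one {a : ι → ℝ} (ha : ∀ j, |a j| ≤ 1) (S : Finset ι) :
    |ofExcluded a S| ≤ 1 := by
  by_cases hS : ∃ j, {j}ᶜ = S
  · obtain ⟨j, rfl⟩ := hS
    simpa only [ofExcluded_compl_singleton] using ha j
  · rw [ofExcluded_of_forall_ne a (not_exists.mp hS), abs_zero]
    exact zero_le_one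

lemma ofExcluded_mul_one_sub (a b : ι → ℝ) (S : Finset ι) :
    ofExcluded (fun j => a j * (1 - b j)) S = ofExcluded a S * (1 - ofExcluded b S) := by
  by_cases hS : ∃ j, {j}ᶜ = S
  · obtain ⟨j, rfl⟩ := hS
    simp only [ofExcluded_compl_singleton]
  · simp only [ofExcluded_of_forall_ne _ (not_exists.mp hS), zero_mul]

lemma sum_ofExcluded_mul (a : ι → ℝ) (q : Finset ι → ℝ) :
    ∑ S, ofExcluded a S * q S = ∑ j, a j * q {j}ᶜ := by
  refine (Finset.sum_of_injOn (fun j => {j}ᶜ) compl_singleton_injective.injOn (by simp)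
    (fun S _ hS => ?_) fun j _ => ?_).symm
  · rw [ofExcluded_of_forall_ne a (by simpa using hS), zero_mul]
  · rw [ofExcluded_compl_singleton]

lemma sum_ofExcluded (a : ι → ℝ) : ∑ S, ofExcluded a S = ∑ j, a j := by
  simpa only [mul_one] using sum_ofExcluded_mul a fun _ => 1

end ExcludedLabel

lemma hasConfusionMatrix_labelMeasure {d K : ℕ} {μ : Measure (EuclideanSpace ℝ (Fin d))}
    {f : EuclideanSpace ℝ (Fin d) → Fin K} (hf : Measurable f)
    {H : Matrix (Fin K) (Finset (Fin K)) ℝ} (h0 : ∀ i S, 0 ≤ H i S) (h1 : ∀ i, ∑ S, H i S = 1) :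
    HasConfusionMatrix (labelMeasure μ fun x => H (f x)) f H := by
  have hH (S : Finset (Fin K)) : Measurable fun x => H (f x) S :=
    (Measurable.of_discrete (f := fun i => H i S)).comp hf
  intro A S hA
  rw [map_fst_labelMeasure hH (fun x => h0 (f x)) fun x => h1 (f x),
    labelMeasure_prod_singleton hH hA]

section HardInstance

variable {K k : ℕ} {X : Type*} [MeasurableSpace X] {μ : Measure X} {f f' : X → Fin K}

/-- The confusion matrix by which a point of label `i` is shown all labels but `j` with probability
proportional to `1 - cosKernel k i j`. -/
noncomputable def cosMatrix (k : ℕ) : Fin K → Finset (Fin K) → ℝ :=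
  fun i => ofExcluded fun j => (K : ℝ)⁻¹ * (1 - cosKernel k i j)

/-- The query that compares the excluded label with the label `f x` through `cosKernel k`. -/
noncomputable def kernelQuery (k : ℕ) (f : X → Fin K) (p : X × Finset (Fin K)) : ℝ :=
  ofExcluded (cosKernel k (f p.1)) p.2

/-- The law of `(x, {j}ᶜ)` where `x` has law `μ` and `j` is an independent uniform label. -/
noncomputable def uniformExcluded (μ : Measure X) (K : ℕ) : Measure (X × Finset (Fin K)) :=
  labelMeasure μ fun _ => ofExcluded fun _ => (K : ℝ)⁻¹

lemma measurable_apply_comp (H : Fin K → Finset (Fin K) → ℝ)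
    (hf : Measurable f) (S : Finset (Fin K)) : Measurable fun x => H (f x) S :=
  (Measurable.of_discrete (f := fun i => H i S)).comp hf

lemma measurable_kernelQuery (hf : Measurable f) : Measurable (kernelQuery k f) :=
  measurable_from_prod_countable_left <|
    measurable_apply_comp (fun i => ofExcluded (cosKernel k i)) hf

lemma labelMeasure_cosMatrix_eq_withDensity (hf : Measurable f) :
    (labelMeasure μ fun x => cosMatrix k (f x)) =
      (uniformExcluded μ K).withDensity fun p => ENNReal.ofReal (1 - kernelQuery k f p) := by
  rw [uniformExcluded, ← labelMeasure_mul_eq_withDensity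
    (h := fun _ => ofExcluded fun _ => (K : ℝ)⁻¹) (fun _ => measurable_const)
    (fun _ => ofExcluded_nonneg fun _ => by positivity) ((measurable_kernelQuery hf).const_sub 1)]
  simp only [kernelQuery, cosMatrix, ← ofExcluded_mul_one_sub]

variable [NeZero K]

lemma cosMatrix_nonneg (k : ℕ) (i : Fin K) (S : Finset (Fin K)) : 0 ≤ cosMatrix k i S :=
  ofExcluded_nonneg (fun j => mul_nonneg (by positivity)
    (sub_nonneg.mpr (abs_le.mp (abs_cosKernel_le_one k i j)).2)) S

lemma sum_cosMatrix (hk : k.Coprime K) (hK : 1 < K) (i : Fin K) : ∑ S, cosMatrix k i S = 1 := by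
  rw [cosMatrix, sum_ofExcluded, ← Finset.mul_sum, Finset.sum_sub_distrib, sum_cosKernel hk hK]
  simp [NeZero.ne K]

lemma isConfusionMatrix_cosMatrix {d : ℕ} (f : EuclideanSpace ℝ (Fin d) → Fin K)
    (hk : k.Coprime K) (hK : 1 < K) {γ : ℝ} (hγ : γ ≤ (K : ℝ)⁻¹ * (1 / (2 * (K : ℝ) ^ 2))) :
    IsConfusionMatrix f γ (cosMatrix k) where
  nonneg := cosMatrix_nonneg k
  row_sum := sum_cosMatrix hk hK
  eq_zero i S hi := by
    by_cases hS : ∃ j, {j}ᶜ = S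
    · obtain ⟨j, rfl⟩ := hS
      have hij : i = j := by simpa using hi
      rw [cosMatrix, ofExcluded_compl_singleton, ← hij, cosKernel_self, sub_self, mul_zero]
    · exact ofExcluded_of_forall_ne _ (not_exists.mp hS)
  le_missing x y hy :=
    calc γ ≤ cosMatrix k (f x) {y}ᶜ := by
          rw [cosMatrix, ofExcluded_compl_singleton]
          exact hγ.trans (mul_le_mul_of_nonneg_left (one_div_le_one_sub_cosKernel hk hy.symm)
            (by positivity))
      _ ≤ _ := Finset.single_le_sum (fun S _ => cosMatrix_nonneg k (f x) S) (by simp)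

omit [MeasurableSpace X] in
lemma abs_kernelQuery_le_one (k : ℕ) (f : X → Fin K) (p : X × Finset (Fin K)) :
    |kernelQuery k f p| ≤ 1 :=
  abs_ofExcluded_le_one (abs_cosKernel_le_one k (f p.1)) p.2

omit [MeasurableSpace X] in
lemma abs_kernelQuery_mul_le_one (k : ℕ) (f f' : X → Fin K) (p : X × Finset (Fin K)) :
    |kernelQuery k f p * kernelQuery k f' p| ≤ 1 := by
  rw [abs_mul]
  exact mul_le_one₀ (abs_kernelQuery_le_one k f p) (abs_nonneg _) (abs_kernelQuery_le_one k f' p)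

instance [IsProbabilityMeasure μ] : IsProbabilityMeasure (uniformExcluded μ K) :=
  isProbabilityMeasure_labelMeasure (fun _ => measurable_const)
    (fun _ => ofExcluded_nonneg fun _ => by positivity) fun _ => by
      simp [sum_ofExcluded, NeZero.ne K]

lemma isProbabilityMeasure_labelMeasure_cosMatrix [IsProbabilityMeasure μ] (hk : k.Coprime K)
    (hK : 1 < K) (hf : Measurable f) :
    IsProbabilityMeasure (labelMeasure μ fun x => cosMatrix k (f x)) :=
  isProbabilityMeasure_labelMeasure (measurable_apply_comp _ hf)
    (fun x => cosMatrix_nonneg k (f x)) fun x => sum_cosMatrix hk hK (f x)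

lemma mk_labelMeasure_cosMatrix_mem {d : ℕ} {f : EuclideanSpace ℝ (Fin d) → Fin K}
    (hf : Measurable f) (hlin : IsLinearClassifier f) (hk : k.Coprime K) (hK : 1 < K) {γ : ℝ}
    (hγ : γ ≤ (K : ℝ)⁻¹ * (1 / (2 * (K : ℝ) ^ 2))) :
    (labelMeasure (stdGaussian (EuclideanSpace ℝ (Fin d))) fun x => cosMatrix k (f x), f) ∈
      contrastiveLabelInstances d K γ := by
  refine ⟨hlin, ?_, cosMatrix k, isConfusionMatrix_cosMatrix f hk hK hγ, fun i S hS =>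
    ofExcluded_of_card_add_one_ne _ (by rwa [Fintype.card_fin]),
    hasConfusionMatrix_labelMeasure hf (cosMatrix_nonneg k) (sum_cosMatrix hk hK)⟩
  exact map_fst_labelMeasure (h := fun x => cosMatrix k (f x)) (measurable_apply_comp _ hf)
    (fun x => cosMatrix_nonneg k (f x)) fun x => sum_cosMatrix hk hK (f x)

variable [IsProbabilityMeasure μ]

lemma integral_kernelQuery_mul (hf : Measurable f) (hf' : Measurable f') :
    ∫ p, kernelQuery k f p * kernelQuery k f' p ∂uniformExcluded μ K =
      ∫ x, (K : ℝ)⁻¹ * ∑ j, cosKernel k (f x) j * cosKernel k (f' x) j ∂μ := by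
  have hint : Integrable (fun p => kernelQuery k f p * kernelQuery k f' p) (uniformExcluded μ K) :=
    .of_bound ((measurable_kernelQuery hf).mul (measurable_kernelQuery hf')).aestronglyMeasurable 1
      (.of_forall (abs_kernelQuery_mul_le_one k f f'))
  rw [uniformExcluded, integral_labelMeasure (h := fun _ => ofExcluded fun _ => (K : ℝ)⁻¹)
    (fun _ => measurable_const) (fun _ => ofExcluded_nonneg fun _ => by positivity) hint]
  simp only [kernelQuery, sum_ofExcluded_mul, ofExcluded_compl_singleton, Finset.mul_sum]

lemma abs_cosKernel_mul_le_one (k : ℕ) (i i' j : Fin K) :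
    |cosKernel k i j * cosKernel k i' j| ≤ 1 := by
  rw [abs_mul]
  exact mul_le_one₀ (abs_cosKernel_le_one k i j) (abs_nonneg _) (abs_cosKernel_le_one k i' j)

lemma integrable_cosKernel_mul (hf : Measurable f) (hf' : Measurable f') (j : Fin K) :
    Integrable (fun x => cosKernel k (f x) j * cosKernel k (f' x) j) μ :=
  have hcos {f : X → Fin K} (hf : Measurable f) : Measurable fun x => cosKernel k (f x) j :=
    (Measurable.of_discrete (f := fun i => cosKernel k i j)).comp hf
  .of_bound ((hcos hf).mul (hcos hf')).aestronglyMeasurable 1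
    (.of_forall fun x => abs_cosKernel_mul_le_one k (f x) (f' x) j)

lemma abs_integral_kernelQuery_mul_le (hf : Measurable f) (hf' : Measurable f') {ε : ℝ}
    (h : ∀ j, |∫ x, cosKernel k (f x) j * cosKernel k (f' x) j ∂μ| ≤ ε) :
    |∫ p, kernelQuery k f p * kernelQuery k f' p ∂uniformExcluded μ K| ≤ ε := by
  have hK : (0 : ℝ) < K := Nat.cast_pos.mpr (NeZero.pos K)
  rw [integral_kernelQuery_mul hf hf', integral_const_mul,
    integral_finsetSum _ fun j _ => integrable_cosKernel_mul hf hf' j, abs_mul, abs_inv,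
    abs_of_pos hK, inv_mul_le_iff₀ hK]
  exact (Finset.abs_sum_le_sum_abs _ _).trans
    ((Finset.sum_le_card_nsmul _ _ _ fun j _ => h j).trans_eq (by simp))

lemma le_average_cosKernel_mul (k : ℕ) (i i' : Fin K) :
    1 / 2 - 3 / 2 * (if i = i' then 0 else 1) ≤
      (K : ℝ)⁻¹ * ∑ j, cosKernel k i j * cosKernel k i' j := by
  have hK : (0 : ℝ) < K := Nat.cast_pos.mpr (NeZero.pos K)
  rw [le_inv_mul_iff₀ hK]
  split_ifs with h
  · subst h
    simpa only [← pow_two] using (le_of_eq (by ring)).trans (le_sum_cosKernel_sq k i)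
  · refine (le_of_eq (by simp; ring)).trans (Finset.card_nsmul_le_sum Finset.univ _ _ fun j _ =>
      neg_le_of_abs_le (abs_cosKernel_mul_le_one k i i' j))

lemma one_div_eight_le_integral_kernelQuery_mul (k : ℕ) (hf : Measurable f) (hf' : Measurable f')
    (herr : μ {x | f x ≠ f' x} ≤ ENNReal.ofReal (1 / 4)) :
    1 / 8 ≤ ∫ p, kernelQuery k f p * kernelQuery k f' p ∂uniformExcluded μ K := by
  set E : Set X := {x | f x ≠ f' x}
  have hE : MeasurableSet E := (measurableSet_eq_fun hf hf').compl
  have hE4 : μ.real E ≤ 1 / 4 := ENNReal.toReal_le_of_le_ofReal (by norm_num) herr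
  have hint : Integrable
      (fun x => (K : ℝ)⁻¹ * ∑ j, cosKernel k (f x) j * cosKernel k (f' x) j) μ :=
    (integrable_finsetSum _ fun j _ => integrable_cosKernel_mul hf hf' j).const_mul _
  have hind : Integrable (fun x => 3 / 2 * E.indicator (1 : X → ℝ) x) μ :=
    ((integrable_const 1).indicator hE).const_mul _
  calc (1 : ℝ) / 8 ≤ 1 / 2 - 3 / 2 * μ.real E := by linarith
    _ = ∫ x, 1 / 2 - 3 / 2 * E.indicator (1 : X → ℝ) x ∂μ := by
      rw [integral_sub (integrable_const _) hind, integral_const_mul, integral_indicator_one hE]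
      simp
    _ ≤ ∫ x, (K : ℝ)⁻¹ * ∑ j, cosKernel k (f x) j * cosKernel k (f' x) j ∂μ :=
      integral_mono ((integrable_const _).sub hind) hint fun x => by
        simpa [E, Set.indicator_apply] using le_average_cosKernel_mul k (f x) (f' x)
    _ = _ := (integral_kernelQuery_mul hf hf').symm

end HardInstance

section PlanarClassifier

variable {K : ℕ} [NeZero K] {E : Type*} [NormedAddCommGroup E] [InnerProductSpace ℝ E]
  [FiniteDimensional ℝ E]

/-- The classifier of the hard instance hidden in the plane `range U`: it reads off the sector of
the orthogonal projection of `x` to that plane. -/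
noncomputable def planarClassifier (K : ℕ) [NeZero K] (U : ℂ →ₗᵢ[ℝ] E) (x : E) : Fin K :=
  sectorIndex K (U.toContinuousLinearMap.adjoint x)

lemma isLinearClassifier_planarClassifier {d : ℕ} (U : ℂ →ₗᵢ[ℝ] EuclideanSpace ℝ (Fin d)) :
    IsLinearClassifier (planarClassifier K U) := by
  refine ⟨fun i => U (polygonVertex i), 0, fun x => ?_⟩
  have hscore (i : Fin K) : inner ℝ (U (polygonVertex i)) x + (0 : Fin K → ℝ) i =
      inner ℝ (polygonVertex i) (U.toContinuousLinearMap.adjoint x) := by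
    simp [ContinuousLinearMap.adjoint_inner_right]
  simp only [hscore]
  exact isLeastArgmax_leastArgmax _

variable [MeasurableSpace E] [BorelSpace E]

lemma measurable_planarClassifier (U : ℂ →ₗᵢ[ℝ] E) : Measurable (planarClassifier K U) :=
  measurable_sectorIndex.comp (ContinuousLinearMap.measurable _)

lemma integral_planarClassifier_mul {U V : ℂ →ₗᵢ[ℝ] E} {r σ : ℝ}
    (hUV : ∀ p q, inner ℝ (U p) (V q) = r * inner ℝ p q) (hrσ : r ^ 2 + σ ^ 2 = 1)
    (g : Fin K → ℝ) :
    ∫ x, g (planarClassifier K U x) * g (planarClassifier K V x) ∂stdGaussian E =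
      ∫ p, g (sectorIndex K p.1) * g (sectorIndex K (r • p.1 + σ • p.2))
        ∂(stdGaussian ℂ).prod (stdGaussian ℂ) := by
  have hg : Measurable fun z => g (sectorIndex K z) :=
    Measurable.of_discrete.comp measurable_sectorIndex
  have hgg (ν : Measure (ℂ × ℂ)) :
      AEStronglyMeasurable (fun p => g (sectorIndex K p.1) * g (sectorIndex K p.2)) ν :=
    ((hg.comp measurable_fst).mul (hg.comp measurable_snd)).aestronglyMeasurable
  have hplane := integral_map (by fun_prop) (hgg ((stdGaussian E).map fun x =>
    (U.toContinuousLinearMap.adjoint x, V.toContinuousLinearMap.adjoint x)))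
  rw [map_adjoint_prod_adjoint_stdGaussian U V hUV hrσ,
    integral_map (by fun_prop) (hgg _)] at hplane
  exact hplane.symm

end PlanarClassifier

lemma exists_abs_integral_cosKernel_planarClassifier_mul_le :
    ∃ M C : ℝ, 1 ≤ M ∧ 1 ≤ C ∧ ∀ {E : Type*} [NormedAddCommGroup E] [InnerProductSpace ℝ E]
      [FiniteDimensional ℝ E] [MeasurableSpace E] [BorelSpace E] {K k : ℕ} [NeZero K],
      2 * k ≤ K → ∀ {U V : ℂ →ₗᵢ[ℝ] E} {r : ℝ},
        (∀ p q, inner ℝ (U p) (V q) = r * inner ℝ p q) → |r| < 1 → ∀ j : Fin K,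
          |∫ x, cosKernel k (planarClassifier K U x) j * cosKernel k (planarClassifier K V x) j
            ∂stdGaussian E| ≤ M * (C * |r|) ^ k := by
  obtain ⟨M, C, hM, hC, hcorr⟩ := exists_abs_integral_prod_mul_le ℂ
  refine ⟨M, C, hM, hC, fun {E} _ _ _ _ _ {K k} _ hk {U V r} hUV hr j => ?_⟩
  have hr2 : 0 < 1 - r ^ 2 := sub_pos.mpr ((sq_lt_one_iff_abs_lt_one r).mpr hr)
  have hrσ : r ^ 2 + √(1 - r ^ 2) ^ 2 = 1 := by rw [Real.sq_sqrt hr2.le, add_sub_cancel]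
  set g : ℂ → ℝ := fun z => cosKernel k (sectorIndex K z) j
  have hg : Measurable g :=
    (Measurable.of_discrete (f := fun i => cosKernel k i j)).comp measurable_sectorIndex
  have hg1 (z : ℂ) : |g z| ≤ 1 := abs_cosKernel_le_one k _ j
  rw [integral_planarClassifier_mul hUV hrσ fun i => cosKernel k i j]
  exact hcorr k g g hg hg hg1 hg1 (fun a z ha => by simp only [g, sectorIndex_smul ha])
    (fun s m hm => integral_inner_pow_mul_cosKernel_sectorIndex hk hm s j) r _
    (Real.sqrt_pos.mpr hr2) hrσ

section LowerBound

variable {V : Type*} [Fintype V] [Nonempty V] {K k : ℕ} [NeZero K] {ε δ : ℝ}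

open Classical in
lemma card_measure_ne_le_lt {X : Type*} [MeasurableSpace X] {μ : Measure X}
    [IsProbabilityMeasure μ] {f : V → X → Fin K} {h : X → Fin K} {τ : ℝ}
    (hf : ∀ v, Measurable (f v)) (hh : Measurable h) (hε : 0 ≤ ε) (hδ : 0 ≤ δ) (hτ : 0 < τ)
    (hτ2 : τ < 1 / 2) (hετ : 64 * (ε + δ / τ) < 1)
    (hcorr : ∀ v, (Finset.card {v' | ε <
      |∫ p, kernelQuery k (f v) p * kernelQuery k (f v') p ∂uniformExcluded μ K|} : ℝ) ≤
        δ * Fintype.card V) :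
    (Finset.card {v | μ {x | h x ≠ f v x} ≤ ENNReal.ofReal (1 / 4)} : ℝ) <
      (Fintype.card V : ℝ) / 2 := by
  have hmem : MemLp (kernelQuery k h) 2 (uniformExcluded μ K) :=
    .of_bound (measurable_kernelQuery hh).aestronglyMeasurable 1
      (.of_forall (abs_kernelQuery_le_one k h))
  have hsq : ∫ p, kernelQuery k h p ^ 2 ∂uniformExcluded μ K ≤ 1 :=
    (integral_mono hmem.integrable_sq (integrable_const 1) fun p =>
      (sq_le_one_iff_abs_le_one _).mpr (abs_kernelQuery_le_one k h p)).trans_eq (by simp)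
  have hsubset (v : V) (hv : μ {x | h x ≠ f v x} ≤ ENNReal.ofReal (1 / 4)) :
      (ε + δ / τ) * ∫ p, kernelQuery k h p ^ 2 ∂uniformExcluded μ K <
        (∫ p, kernelQuery k h p * kernelQuery k (f v) p ∂uniformExcluded μ K) ^ 2 :=
    calc _ ≤ (ε + δ / τ) * 1 := by gcongr
      _ < (1 / 8) ^ 2 := by linarith
      _ ≤ _ := by
        gcongr
        exact one_div_eight_le_integral_kernelQuery_mul k hh (hf v) hv
  have hV : (0 : ℝ) < Fintype.card V := Nat.cast_pos.mpr Fintype.card_pos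
  calc _ ≤ (Finset.card {v | (ε + δ / τ) * ∫ p, kernelQuery k h p ^ 2 ∂uniformExcluded μ K <
        (∫ p, kernelQuery k h p * kernelQuery k (f v) p ∂uniformExcluded μ K) ^ 2} : ℝ) :=
        Nat.cast_le.mpr (Finset.card_le_card (Finset.monotone_filter_right _ fun v _ => hsubset v))
    _ ≤ τ * Fintype.card V :=
        card_lt_sq_integral_mul_le (fun v => measurable_kernelQuery (hf v))
          (fun v => abs_kernelQuery_le_one k (f v)) hε hδ hτ hcorr hmem
    _ < Fintype.card V / 2 := by nlinarith

variable {d : ℕ}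

open Classical in
lemma learningRequires_contrastiveLabelInstances_of_card_le
    {f : V → EuclideanSpace ℝ (Fin d) → Fin K} {γ N U : ℝ} (hf : ∀ v, Measurable (f v))
    (hlin : ∀ v, IsLinearClassifier (f v)) (hk : k.Coprime K) (hK : 1 < K)
    (hγ : γ ≤ (K : ℝ)⁻¹ * (1 / (2 * (K : ℝ) ^ 2))) (hε : 0 ≤ ε) (hδ : 0 ≤ δ) (hN : 1 ≤ N)
    (hU : 0 < U) (hNU : 64 * (U + 1) * (ε + 12 * N * δ) ≤ 1)
    (hcorr : ∀ v, (Finset.card {v' | ε < |∫ p, kernelQuery k (f v) p * kernelQuery k (f v') p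
      ∂uniformExcluded (stdGaussian (EuclideanSpace ℝ (Fin d))) K|} : ℝ) ≤ δ * Fintype.card V) :
    LearningRequires (contrastiveLabelInstances d K γ) (1 / 4) N U := by
  intro Ω _ μ _ A hA
  set P : V → Measure (EuclideanSpace ℝ (Fin d) × Finset (Fin K)) := fun v =>
    labelMeasure (stdGaussian (EuclideanSpace ℝ (Fin d))) fun x => cosMatrix k (f v x)
  have hP (v : V) : IsProbabilityMeasure (P v) :=
    isProbabilityMeasure_labelMeasure_cosMatrix hk hK (hf v)
  have hmem (v : V) : (P v, f v) ∈ contrastiveLabelInstances d K γ :=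
    mk_labelMeasure_cosMatrix_mem (hf v) (hlin v) hk hK hγ
  obtain ⟨τ, hτ, hτN, hδτ⟩ : ∃ τ, 0 < τ ∧ N * τ = 1 / 12 ∧ δ / τ = 12 * N * δ :=
    ⟨1 / (12 * N), by positivity, by field, by field⟩
  rw [← hδτ] at hNU
  have : 0 ≤ ε + δ / τ := by positivity
  have hτN' : ⌊N⌋₊ * (2 * τ) ≤ 1 / 6 := by
    nlinarith [Nat.floor_le (zero_le_one.trans hN)]
  have hvalid (q : StatQuery (EuclideanSpace ℝ (Fin d) × Finset (Fin K))) (u : ℝ) (hu : 0 < u)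
      (huU : u < U) : (Finset.card {v | ¬ IsVSTATAnswer (P v) q u (∫ p, q.toFun p
        ∂uniformExcluded (stdGaussian (EuclideanSpace ℝ (Fin d))) K)} : ℝ) ≤
          2 * τ * Fintype.card V :=
    card_not_isVSTATAnswer_le (Q := P) (G := fun v => kernelQuery k (f v))
      (fun v => measurable_kernelQuery (hf v)) (fun v => abs_kernelQuery_le_one k (f v))
      (fun v => labelMeasure_cosMatrix_eq_withDensity (hf v)) hε hδ hτ hcorr q hu (by nlinarith)
  set R : V → Hypothesis d K → Prop := fun v h =>
    stdGaussian (EuclideanSpace ℝ (Fin d)) {x | h.1 x ≠ f v x} ≤ ENNReal.ofReal (1 / 4)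
  have hbad (h : Hypothesis d K) : (Finset.card {v | R v h} : ℝ) < (Fintype.card V : ℝ) / 2 :=
    card_measure_ne_le_lt hf h.2 hε hδ hτ (by nlinarith) (by nlinarith) hcorr
  obtain ⟨v, O, hO, hpos⟩ := exists_isVSTAT_measure_pos (P := P) (R := R) (by positivity) hτN'
    hvalid hbad A fun v O hO => hA _ _ (hmem v) O hO
  exact ⟨P v, f v, hmem v, O, hO, hpos⟩

end LowerBound

lemma exists_learningRequires_contrastiveLabelInstances :
    ∃ M C : ℝ, 1 ≤ M ∧ 1 ≤ C ∧ ∀ {d n K k : ℕ}, 0 < n → 2 * n ≤ d → 1 < K → k.Coprime K →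
      2 * k ≤ K → ∀ {γ t N U : ℝ}, γ ≤ (K : ℝ)⁻¹ * (1 / (2 * (K : ℝ) ^ 2)) → 0 ≤ t → t < 1 →
        1 ≤ N → 0 < U →
        64 * (U + 1) * (M * (C * t) ^ k + 24 * N * Real.exp (-(n * t ^ 2 / 2))) ≤ 1 →
        LearningRequires.{u} (contrastiveLabelInstances d K γ) (1 / 4) N U := by
  classical
  obtain ⟨M, C, hM, hC, hcos⟩ := exists_abs_integral_cosKernel_planarClassifier_mul_le
  refine ⟨M, C, hM, hC, fun {d n K k} hn hnd hK hk hkK {γ t N U} hγ ht ht1 hN hU hNU => ?_⟩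
  have : NeZero K := ⟨by omega⟩
  have : NeZero n := ⟨hn.ne'⟩
  obtain ⟨P, hP⟩ := exists_linearIsometry_inner_eq_signMean_mul (ι := Fin n) (F := ℂ)
    (E := EuclideanSpace ℝ (Fin d)) (by simpa [mul_comm] using hnd)
  have hcorr (v v' : Fin n → ℤˣ) (hvv' : |signMean (v * v')| ≤ t) :
      |∫ p, kernelQuery k (planarClassifier K (P v)) p * kernelQuery k (planarClassifier K (P v')) p
        ∂uniformExcluded (stdGaussian (EuclideanSpace ℝ (Fin d))) K| ≤ M * (C * t) ^ k :=
    abs_integral_kernelQuery_mul_le (measurable_planarClassifier _) (measurable_planarClassifier _)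
      fun j => (hcos hkK (hP v v') (hvv'.trans_lt ht1) j).trans (by gcongr)
  refine learningRequires_contrastiveLabelInstances_of_card_le
    (ε := M * (C * t) ^ k) (δ := 2 * Real.exp (-(n * t ^ 2 / 2)))
    (fun v => measurable_planarClassifier (P v))
    (fun v => isLinearClassifier_planarClassifier (P v)) hk hK hγ (by positivity) (by positivity)
    hN hU (hNU.trans_eq' (by ring)) fun v => ?_
  calc _ ≤ (Finset.card {v' | t < |signMean (v * v')|} : ℝ) :=
        Nat.cast_le.mpr (Finset.card_le_card (Finset.monotone_filter_right _ fun v' _ h =>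
          lt_of_not_ge fun hvv' => h.not_ge (hcorr v v' hvv')))
    _ ≤ _ := by simpa using card_lt_abs_signMean_mul_le v ht

section Parameters

open Filter Asymptotics

lemma mul_rpow_mul_mul_pow_le_one {x β κ M C : ℝ} {k : ℕ} (hx : 1 ≤ x) (hβ : 0 ≤ β) (hM : 1 ≤ M)
    (hC : 0 ≤ C) (hk : 0 < k) (hκ : κ ≤ 6 * k) (hxMC : 256 * M * C ≤ x ^ (β / 2)) :
    256 * x ^ (β / 12 * κ) * (M * (C * x ^ (-β)) ^ k) ≤ 1 := by
  have hx0 : 0 < x := zero_lt_one.trans_le hx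
  have hU : x ^ (β / 12 * κ) ≤ (x ^ (β / 2)) ^ k := by
    rw [← Real.rpow_mul_natCast hx0.le]
    exact Real.rpow_le_rpow_of_exponent_le hx (by nlinarith)
  have hbase : 256 * M * x ^ (β / 2) * (C * x ^ (-β)) ≤ 1 :=
    calc _ = 256 * M * C * (x ^ (β / 2) * x ^ (-β)) := by ring
      _ = 256 * M * C / x ^ (β / 2) := by
        rw [← Real.rpow_add hx0, div_eq_mul_inv (256 * M * C), ← Real.rpow_neg hx0.le]
        congr 2
        ring
      _ ≤ 1 := div_le_one_of_le₀ hxMC (by positivity)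
  calc _ = 256 * M * (x ^ (β / 12 * κ) * (C * x ^ (-β)) ^ k) := by ring
    _ ≤ (256 * M) ^ k * ((x ^ (β / 2)) ^ k * (C * x ^ (-β)) ^ k) := by
      gcongr
      exact le_self_pow₀ (by linarith) hk.ne'
    _ = (256 * M * x ^ (β / 2) * (C * x ^ (-β))) ^ k := by rw [mul_pow, mul_pow]; ring
    _ ≤ 1 := pow_le_one₀ (by positivity) hbase

lemma isLittleO_rpow_rpow_atTop {a b : ℝ} (h : a < b) :
    (fun x : ℝ => x ^ a) =o[atTop] fun x => x ^ b := by
  refine isLittleO_of_tendsto' ?_ ?_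
  · filter_upwards [eventually_gt_atTop 0] with x hx h0
    exact absurd h0 (by positivity)
  · refine (tendsto_rpow_neg_atTop (sub_pos.mpr h)).congr' ?_
    filter_upwards [eventually_gt_atTop 0] with x hx
    rw [neg_sub, Real.rpow_sub hx]

lemma isLittleO_rpow_mul_log_rpow_atTop {a b : ℝ} (h : a < b) :
    (fun x : ℝ => x ^ a * Real.log x) =o[atTop] fun x => x ^ b := by
  refine ((isBigO_refl (fun x : ℝ => x ^ a) atTop).mul_isLittleO
    (isLittleO_log_rpow_atTop (sub_pos.mpr h))).congr' .rfl ?_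
  filter_upwards [eventually_gt_atTop 0] with x hx
  rw [← Real.rpow_add hx, add_sub_cancel]

lemma eventually_mul_rpow_mul_two_rpow_mul_exp_le_one {α β : ℝ} (hβ : 0 ≤ β)
    (hαβ : α < 1 - 2 * β) (hβ1 : β / 12 < 1 - 2 * β) :
    ∀ᶠ x : ℝ in atTop, ∀ {κ n : ℝ}, κ ≤ x ^ α → x ≤ 4 * n →
      6144 * x ^ (β / 12 * κ) * 2 ^ x ^ (β / 12) * Real.exp (-(n * (x ^ (-β)) ^ 2 / 2)) ≤ 1 := by
  have hlog : ∀ᶠ x : ℝ in atTop,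
      ‖Real.log 6144 * x ^ (0 : ℝ) + x ^ α * Real.log x + x ^ (β / 12)‖ ≤
        1 / 8 * ‖x ^ (1 - 2 * β)‖ :=
    ((((isLittleO_rpow_rpow_atTop (by linarith)).const_mul_left _).add
      (isLittleO_rpow_mul_log_rpow_atTop hαβ)).add (isLittleO_rpow_rpow_atTop hβ1)).bound
        (by norm_num)
  filter_upwards [hlog, eventually_ge_atTop 1] with x hlog hx κ n hκ hn
  have hx0 : 0 < x := zero_lt_one.trans_le hx
  have hlog0 : 0 ≤ Real.log x := Real.log_nonneg hx
  rw [Real.norm_of_nonneg (by positivity), Real.norm_of_nonneg (by positivity), Real.rpow_zero,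
    mul_one] at hlog
  have hU : x ^ (β / 12 * κ) ≤ Real.exp (x ^ α * Real.log x) := by
    rw [Real.rpow_def_of_pos hx0, mul_comm]
    gcongr
    nlinarith [Real.rpow_nonneg hx0.le α]
  have hN : (2 : ℝ) ^ x ^ (β / 12) ≤ Real.exp (x ^ (β / 12)) := by
    rw [← Real.exp_one_rpow]
    gcongr
    exact Real.exp_one_gt_two.le
  have hexp : x ^ (1 - 2 * β) / 8 ≤ n * (x ^ (-β)) ^ 2 / 2 :=
    calc _ = x / 4 * (x ^ (-β)) ^ 2 / 2 := by
          rw [sub_eq_add_neg, Real.rpow_one_add' hx0.le (by linarith),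
            ← Real.rpow_mul_natCast hx0.le]
          ring_nf
      _ ≤ _ := by gcongr; linarith
  calc _ ≤ Real.exp (Real.log 6144) * Real.exp (x ^ α * Real.log x) * Real.exp (x ^ (β / 12)) *
          Real.exp (-(x ^ (1 - 2 * β) / 8)) := by
        rw [Real.exp_log (by norm_num)]
        gcongr
    _ ≤ 1 := by
        rw [← Real.exp_add, ← Real.exp_add, ← Real.exp_add, Real.exp_le_one_iff]
        linarith

lemma eventually_mul_add_le_one {α β M C : ℝ} (hβ : 0 < β) (hαβ : α < 1 - 2 * β)
    (hβ1 : β / 12 < 1 - 2 * β) (hM : 1 ≤ M) (hC : 0 ≤ C) :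
    ∀ᶠ d : ℕ in atTop, ∀ {K k : ℕ}, 0 < k → K ≤ 6 * k → (K : ℝ) ≤ (d : ℝ) ^ α →
      64 * ((d : ℝ) ^ (β / 12 * K) + 1) * (M * (C * (d : ℝ) ^ (-β)) ^ k +
        24 * 2 ^ (d : ℝ) ^ (β / 12) *
          Real.exp (-((d / 2 : ℕ) * ((d : ℝ) ^ (-β)) ^ 2 / 2))) ≤ 1 := by
  filter_upwards [tendsto_natCast_atTop_atTop.eventually
      (eventually_mul_rpow_mul_two_rpow_mul_exp_le_one hβ.le hαβ hβ1),
    tendsto_natCast_atTop_atTop.eventually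
      ((tendsto_rpow_atTop (half_pos hβ)).eventually_ge_atTop (256 * M * C)),
    eventually_ge_atTop 2] with d htail hMC hd K k hk hKk hKd
  have hd1 : (1 : ℝ) ≤ d := mod_cast one_le_two.trans hd
  have hU : 1 ≤ (d : ℝ) ^ (β / 12 * K) := Real.one_le_rpow hd1 (by positivity)
  have hmoment := mul_rpow_mul_mul_pow_le_one (κ := K) hd1 hβ.le hM hC hk (mod_cast hKk) hMC
  have htail := htail (n := (d / 2 : ℕ)) hKd (mod_cast (by omega : d ≤ 4 * (d / 2)))
  calc _ ≤ 64 * ((d : ℝ) ^ (β / 12 * K) + (d : ℝ) ^ (β / 12 * K)) * _ := by gcongr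
    _ ≤ 1 := by linear_combination (hmoment + htail) / 2

end Parameters

lemma LearningRequires.mono {d K : ℕ} {I J : Set (Measure (EuclideanSpace ℝ (Fin d) ×
    Finset (Fin K)) × (EuclideanSpace ℝ (Fin d) → Fin K))} {ε ε' N U : ℝ} (hIJ : I ⊆ J)
    (hε : ε' ≤ ε) (h : LearningRequires.{u} I ε N U) : LearningRequires.{u} J ε' N U := by
  intro Ω _ μ _ A hA
  obtain ⟨D, f, hD, hO⟩ := h Ω μ A fun D f hDf O hO =>
    let ⟨G, hG, hμG, herr⟩ := hA D f (hIJ hDf) O hO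
    ⟨G, hG, hμG, fun ω hω => (herr ω hω).trans (ENNReal.ofReal_le_ofReal hε)⟩
  exact ⟨D, f, hIJ hD, hO⟩

lemma contrastiveLabelInstances_subset (d K : ℕ) (γ : ℝ) :
    contrastiveLabelInstances d K γ ⊆ partialLabelInstances d K γ :=
  fun _ ⟨hlin, hmap, H, hH, _, hD⟩ => ⟨hlin, hmap, H, hH, hD⟩

theorem theoremE2_general :
    ∃ C : ℕ, ∀ α : ℝ, 0 < α → α < 1 → ∃ c : ℝ, 0 < c ∧ ∃ d₀ : ℕ,
      ∀ d K : ℕ, d₀ ≤ d → 2 ≤ K → (K : ℝ) ≤ (d : ℝ) ^ α → ∀ γ : ℝ, γ ≤ 1 / (K : ℝ) ^ C →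
        LearningRequires.{u} (contrastiveLabelInstances d K γ) (1 / 4)
          ((2 : ℝ) ^ ((d : ℝ) ^ c)) ((d : ℝ) ^ (c * (K : ℝ))) := by
  obtain ⟨M, C, hM, hC, hlower⟩ := exists_learningRequires_contrastiveLabelInstances.{u}
  refine ⟨4, fun α hα hα1 => ?_⟩
  obtain ⟨β, rfl⟩ : ∃ β, α = 1 - 4 * β := ⟨(1 - α) / 4, by ring⟩
  have hβ : 0 < β := by linarith
  obtain ⟨d₀, hd₀⟩ := Filter.eventually_atTop.mp
    (eventually_mul_add_le_one (α := 1 - 4 * β) hβ (by linarith) (by linarith) hM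
      (zero_le_one.trans hC))
  refine ⟨β / 12, by positivity, max d₀ 2, fun d K hd hK hKd γ hγ => ?_⟩
  have hd2 : 2 ≤ d := (le_max_right _ _).trans hd
  have hγ' : γ ≤ (K : ℝ)⁻¹ * (1 / (2 * (K : ℝ) ^ 2)) := by
    have hK' : (2 : ℝ) ≤ K := mod_cast hK
    calc γ ≤ 1 / (K * (K : ℝ) ^ 3) := hγ.trans_eq (by ring)
      _ ≤ 1 / (2 * (K : ℝ) ^ 3) := by gcongr
      _ = _ := by ring
  obtain ⟨k, hk, hkK, h2k, h6k⟩ := exists_coprime_of_two_le hK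
  exact hlower (n := d / 2) (by omega) (by omega) hK hkK h2k hγ' (by positivity)
    (Real.rpow_lt_one_of_one_lt_of_neg (Nat.one_lt_cast.mpr hd2) (neg_neg_of_pos hβ))
    (Real.one_le_rpow one_le_two (by positivity)) (by positivity)
    (hd₀ d ((le_max_left _ _).trans hd) hk h6k hKd)

theorem theoremE2 :
    ∃ C : ℕ, ∀ α : ℝ, 0 < α → α < 1 → ∃ c : ℝ, 0 < c ∧ ∃ d₀ : ℕ,
      ∀ d K : ℕ, d₀ ≤ d → 2 ≤ K → (K : ℝ) ≤ (d : ℝ) ^ α →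
        ∀ γ : ℝ, 0 < γ → γ ≤ 1 / (K : ℝ) ^ C →
          LearningRequires.{u} (partialLabelInstances d K γ) (1 / (2 * (K : ℝ)))
              ((2 : ℝ) ^ ((d : ℝ) ^ c)) ((d : ℝ) ^ (c * (K : ℝ))) ∧
            LearningRequires.{u} (contrastiveLabelInstances d K γ) (1 / (2 * (K : ℝ)))
              ((2 : ℝ) ^ ((d : ℝ) ^ c)) ((d : ℝ) ^ (c * (K : ℝ))) := by
  obtain ⟨C, hlower⟩ := theoremE2_general.{u}
  refine ⟨C, fun α hα hα1 => (hlower α hα hα1).imp fun c => And.imp_right <| .imp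
    fun d₀ h d K hd hK hKd γ _ hγ => ?_⟩
  have hε : 1 / (2 * (K : ℝ)) ≤ 1 / 4 :=
    one_div_le_one_div_of_le four_pos (by norm_cast; omega)
  exact ⟨(h d K hd hK hKd γ hγ).mono (contrastiveLabelInstances_subset d K γ) hε,
    (h d K hd hK hKd γ hγ).mono subset_rfl hε⟩
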